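/- Let $h_l$ ($l=0,1,2,\dots$) be the Hermite polynomials that are orthonormal in $L^2(\mathbb R, e^{-x^2}dx)$, and let $p_l^{(-1/2)}$ be the Laguerre polynomials that are orthonormal in $L^2([0,\infty), x^{-1/2}e^{-x}dx)$, all with positive leading coefficients; put $h_{-2}=0$. Let $a_l$, $b_l=b_l^{(-1/2)}$ be the coefficients of the three-term recurrence $$b_{l+1}\,p_{l+1}^{(-1/2)}(x)=(x-a_l)\,p_l^{(-1/2)}(x)-b_l\,p_{l-1}^{(-1/2)}(x),\qquad p_{-1}^{(-1/2)}=0,\quad p_0^{(-1/2)}=1/b_0 .$$ For an integer $k\ge 0$ the associated Laguerre polynomials $p_l^{(-1/2)}(x,k)$ are defined by $$b_{k+l+1}\,p_{l+1}^{(-1/2)}(x,k)=(x-a_{k+l})\,p_l^{(-1/2)}(x,k)-b_{k+l}\,p_{l-1}^{(-1/2)}(x,k),\qquad p_{-1}^{(-1/2)}(x,k)=0,\quad p_0^{(-1/2)}(x,k)=1 .$$ Let $0\le m\le n$ be even integers. Let $\mathbb S_n^m$ be the set of all $P=\sum_{l=m}^n c_l h_l$ with $c_l\in\mathbb C$ and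 $\int_{\mathbb R}|P(x)|^2e^{-x^2}dx=1$, and put $\mathbb S_n=\mathbb S_n^0$. Let $\mathcal H_n$ and $\mathcal H_n^m$ denote the minimizers of $\operatorname{var}_S(P)=\int_{\mathbb R}x^2|P(x)|^2e^{-x^2}dx$ over $\mathbb S_n$ and over $\mathbb S_n^m$, respectively. Let $\lambda$ be the smallest zero of $p_{n/2+1}^{(-1/2)}(x)$ and $\mu$ the smallest zero of $p_{(n-m)/2+1}^{(-1/2)}(x,\tfrac m2)$. Then these minimizers exist, and they are exactly the polynomials in $\mathbb S_n$, respectively $\mathbb S_n^m$, of the form $$\mathcal H_n(x)=\kappa_1\, b_{\frac n2+1}\,p_{\frac n2}^{(-1/2)}(\lambda)\,\frac{h_{n+2}(x)}{x^2-\lambda}\qquad(x^2\ne\lambda),$$ $$\mathcal H_n^m(x)=\kappa_2\,\frac{b_{\frac n2+1}\,p_{\frac{n-m}2}^{(-1/2)}(\mu,\tfrac m2)\,h_{n+2}(x)+b_{\frac m2}\,h_{m-2}(x)}{x^2-\mu}\qquad(x^2\ne\mu),$$ with constants $\kappa_1,\kappa_2\in\mathbb C$ (which are determined, up to a factor of absolute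 value one, by the normalization). Equivalently, with the same constants, $$\mathcal H_n(x)=\kappa_1\sum_{l=0}^{n/2}p_l^{(-1/2)}(\lambda)\,h_{2l}(x),\qquad \mathcal H_n^m(x)=\kappa_2\sum_{l=m/2}^{n/2}p_{l-\frac m2}^{(-1/2)}(\mu,\tfrac m2)\,h_{2l}(x).$$ -/

import Mathlib

open Polynomial

noncomputable section

namespace OptHermite

/-- The inner product `∫ p(x) q(x) w(x) dx` of two real polynomials for a weight `w` on `ℝ`. -/
def weightedInner (w : ℝ → ℝ) (p q : ℝ[X]) : ℝ :=
  ∫ x : ℝ, p.eval x * q.eval x * w x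

/-- The monic orthogonal polynomials for the weight `w`: Gram–Schmidt orthogonalization of
`1, X, X², …`. -/
def monicOrtho (w : ℝ → ℝ) (l : ℕ) : ℝ[X] :=
  X ^ l - ∑ k : Fin l,
    C (weightedInner w (X ^ l) (monicOrtho w k) /
        weightedInner w (monicOrtho w k) (monicOrtho w k)) * monicOrtho w k
termination_by l
decreasing_by all_goals exact k.isLt

/-- The orthonormal polynomial of degree `l` with positive leading coefficient
for the weight `w`. -/
def orthonormalPoly (w : ℝ → ℝ) (l : ℕ) : ℝ[X] :=
  C (1 / √(weightedInner w (monicOrtho w l) (monicOrtho w l))) * monicOrtho w l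

/-- The diagonal coefficient `a_l = ⟨x p_l, p_l⟩` of the three-term recurrence
`b_{l+1} p_{l+1} = (x - a_l) p_l - b_l p_{l-1}`. -/
def recA (w : ℝ → ℝ) (l : ℕ) : ℝ :=
  weightedInner w (X * orthonormalPoly w l) (orthonormalPoly w l)

/-- The off-diagonal coefficients `b_l` of the three-term recurrence: `b_{l+1} = ⟨x p_l, p_{l+1}⟩`,
and `b_0 = (∫ w)^{1/2}`, so that `p_0 = 1 / b_0`. -/
def recB (w : ℝ → ℝ) : ℕ → ℝ
  | 0 => √(weightedInner w 1 1)
  | l + 1 => weightedInner w (X * orthonormalPoly w l) (orthonormalPoly w (l + 1))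

/-- The associated polynomials `p_l(x, m)`, given by `p_{-1}(x, m) = 0`, `p_0(x, m) = 1` and
`b_{m+l+1} p_{l+1}(x, m) = (x - a_{m+l}) p_l(x, m) - b_{m+l} p_{l-1}(x, m)`. -/
def assocPoly (w : ℝ → ℝ) (m : ℕ) : ℕ → ℝ[X]
  | 0 => 1
  | 1 => C (recB w (m + 1))⁻¹ * (X - C (recA w m))
  | l + 2 => C (recB w (m + (l + 1) + 1))⁻¹ *
      ((X - C (recA w (m + (l + 1)))) * assocPoly w m (l + 1)
        - C (recB w (m + (l + 1))) * assocPoly w m l)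

/-- The Hermite weight `e^{-x²}` on `ℝ`. -/
def hermiteWeight (x : ℝ) : ℝ := Real.exp (-x ^ 2)

/-- The Laguerre weight `x^α e^{-x}` on the half-line, extended by zero to `ℝ`. -/
def laguerreWeight (α : ℝ) : ℝ → ℝ :=
  (Set.Ioi (0 : ℝ)).indicator fun x => x ^ α * Real.exp (-x)

/-- The orthonormal Hermite polynomials `h_l`. -/
def hermiteON (l : ℕ) : ℝ[X] := orthonormalPoly hermiteWeight l

/-- The orthonormal Laguerre polynomials `p_l^{(α)}`. -/
def laguerreON (α : ℝ) (l : ℕ) : ℝ[X] := orthonormalPoly (laguerreWeight α) l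

/-- The recurrence coefficients `b_l^{(α)}` of the orthonormal Laguerre polynomials. -/
def laguerreB (α : ℝ) (l : ℕ) : ℝ := recB (laguerreWeight α) l

/-- The associated Laguerre polynomials `p_l^{(α)}(x, m)`. -/
def laguerreAssoc (α : ℝ) (m l : ℕ) : ℝ[X] := assocPoly (laguerreWeight α) m l

/-- The position variance `∫ x² |f(x)|² e^{-x²} dx`. -/
def varS (f : ℝ → ℂ) : ℝ := ∫ x : ℝ, x ^ 2 * ‖f x‖ ^ 2 * Real.exp (-x ^ 2)

/-- The squared norm `∫ |f(x)|² e^{-x²} dx` of `L²(ℝ, e^{-x²})`. -/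
def normSqH (f : ℝ → ℂ) : ℝ := ∫ x : ℝ, ‖f x‖ ^ 2 * Real.exp (-x ^ 2)

/-- A complex polynomial as a function on the real line. -/
def onReal (P : ℂ[X]) : ℝ → ℂ := fun x => P.eval (x : ℂ)

/-- `Π_n^m`: the complex span of the Hermite polynomials `h_l`, `m ≤ l ≤ n`. -/
def spaceMN (m n : ℕ) : Submodule ℂ ℂ[X] :=
  Submodule.span ℂ ((fun l => (hermiteON l).map Complex.ofRealHom) '' Set.Icc m n)

/-- `Π_n`: the complex span of the Hermite polynomials `h_l`, `0 ≤ l ≤ n`. -/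
def spaceN (n : ℕ) : Submodule ℂ ℂ[X] := spaceMN 0 n

/-- The elements of norm one of a space of polynomials. -/
def unitSphere (V : Submodule ℂ ℂ[X]) : Set ℂ[X] :=
  {P | P ∈ V ∧ normSqH (onReal P) = 1}

/-- `P` minimizes the position variance over the unit sphere of `V`. -/
def IsOptimal (V : Submodule ℂ ℂ[X]) (P : ℂ[X]) : Prop :=
  P ∈ unitSphere V ∧ ∀ Q ∈ unitSphere V, varS (onReal P) ≤ varS (onReal Q)

end OptHermite

end

/-! Expand `P` in Hermite polynomials. Multiplication by `x²` couples `h_k` only to `h_{k-2}`, `h_k`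
and `h_{k+2}`, so `var_S` splits into a quadratic form in the even coefficients and one in the odd
coefficients, each given by a truncated Jacobi matrix. Real and imaginary parts of the coefficients
separate as well, so real forms suffice.

Since `h_{2l}(x) = p_l(x²)` with Laguerre polynomials of parameter `-1/2` (`laguerreON_comp_X_sq`),
the even block is the Laguerre Jacobi matrix with its indices shifted by `m/2`. The least eigenvalue
of such a matrix is the least zero of the associated polynomial of the next degree, and it is
simple: the eigenvector consists of the values of the lower polynomials at that zero
(`exists_isLeast_jacobiSol`).

The odd block must be shown not to compete. It has one dimension less, and its form dominates the
even one of the same size by a discrete Hardy inequality (`jacobiForm_even_le_odd`). An odd vector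
reaching the even minimum would, padded by a zero, be a minimal even eigenvector with vanishing last
entry; that is impossible unless it is zero (`le_jacobiForm_odd_and_eq_zero`).

Hence the minimizers are the normalized multiples of one explicit sum (`exists_isLeast_isOptimal`),
which a Christoffel–Darboux formula puts in closed form (`sub_mul_sum_jacobiSol_mul`). -/

namespace OptHermite

/-! ### Orthonormal polynomials of a general weight and their three-term recurrence. -/

open MeasureTheory

/-- A weight on `ℝ` with finite moments that is positive definite on polynomials. -/
structure IsRegularWeight (w : ℝ → ℝ) : Prop where
  integrable (p : ℝ[X]) : Integrable fun x => p.eval x * w x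
  pos (p : ℝ[X]) (hp : p ≠ 0) : 0 < ∫ x, (p * p).eval x * w x

namespace IsRegularWeight

variable {w : ℝ → ℝ}

/-- Integration of polynomials against a regular weight, as a linear functional. -/
noncomputable def integral (hw : IsRegularWeight w) : ℝ[X] →ₗ[ℝ] ℝ where
  toFun p := ∫ x, p.eval x * w x
  map_add' p q := by
    simp only [eval_add, add_mul]
    exact integral_add (hw.integrable p) (hw.integrable q)
  map_smul' c p := by
    simp only [eval_smul, smul_eq_mul, mul_assoc, RingHom.id_apply]
    exact integral_const_mul c _

theorem integral_apply (hw : IsRegularWeight w)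
    (p : ℝ[X]) : hw.integral p = ∫ x, p.eval x * w x := rfl

theorem weightedInner_eq (hw : IsRegularWeight w)
    (p q : ℝ[X]) : weightedInner w p q = hw.integral (p * q) := by
  simp [weightedInner, integral_apply]

theorem integral_mul_self_pos (hw : IsRegularWeight w)
    {p : ℝ[X]} (hp : p ≠ 0) : 0 < hw.integral (p * p) := hw.pos p hp

theorem integral_C_mul (hw : IsRegularWeight w)
    (c : ℝ) (p : ℝ[X]) : hw.integral (C c * p) = c * hw.integral p := by
  rw [← smul_eq_C_mul, map_smul, smul_eq_mul]

theorem eq_zero_of_integral_mul_self (hw : IsRegularWeight w)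
    {p : ℝ[X]} (hp : hw.integral (p * p) = 0) : p = 0 := by
  by_contra h
  exact (hw.integral_mul_self_pos h).ne' hp

end IsRegularWeight

theorem monicOrtho_monic_and_degree (w : ℝ → ℝ) (l : ℕ) :
    (monicOrtho w l).Monic ∧ (monicOrtho w l).degree = l := by
  induction l using Nat.strong_induction_on with
  | _ l ih =>
    rw [monicOrtho]
    set S := ∑ k : Fin l, C (weightedInner w (X ^ l) (monicOrtho w k) /
        weightedInner w (monicOrtho w k) (monicOrtho w k)) * monicOrtho w k with hS
    have hdeg : S.degree < l := by
      rw [← mem_degreeLT]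
      refine Submodule.sum_mem _ fun k _ => ?_
      rw [← smul_eq_C_mul]
      refine Submodule.smul_mem _ _ ?_
      rw [mem_degreeLT, (ih k k.isLt).2]
      exact_mod_cast k.isLt
    refine ⟨monic_X_pow_sub hdeg, ?_⟩
    rw [degree_sub_eq_left_of_degree_lt (by simpa using hdeg), degree_X_pow]

theorem monicOrtho_monic (w : ℝ → ℝ) (l : ℕ) : (monicOrtho w l).Monic :=
  (monicOrtho_monic_and_degree w l).1

theorem degree_monicOrtho (w : ℝ → ℝ) (l : ℕ) : (monicOrtho w l).degree = l :=
  (monicOrtho_monic_and_degree w l).2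

/-- Subtracting the right multiple of a polynomial of degree `n` lowers the degree. -/
theorem degree_sub_C_mul_lt {p q : ℝ[X]} {n : ℕ} (hp : p.degree < (n + 1 : ℕ))
    (hq : q.degree = n) : (p - C (p.coeff n / q.leadingCoeff) * q).degree < n := by
  have hq0 : q ≠ 0 := by rintro rfl; simp at hq
  have hlc : q.coeff n = q.leadingCoeff := by
    rw [leadingCoeff, natDegree_eq_of_degree_eq_some hq]
  rw [degree_lt_iff_coeff_zero]
  intro k hk
  rcases hk.eq_or_lt with rfl | hk
  · rw [coeff_sub, coeff_C_mul, hlc, div_mul_cancel₀ _ (leadingCoeff_ne_zero.2 hq0), sub_self]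
  · rw [degree_lt_iff_coeff_zero] at hp
    rw [coeff_sub, coeff_C_mul, hp k hk, coeff_eq_zero_of_degree_lt (p := q)]
    · simp
    · rw [hq]; exact_mod_cast hk

namespace IsRegularWeight

variable {w : ℝ → ℝ}

theorem integral_monicOrtho_mul_monicOrtho (hw : IsRegularWeight w) (l k : ℕ) (hk : k < l) :
    hw.integral (monicOrtho w l * monicOrtho w k) = 0 := by
  induction l using Nat.strong_induction_on generalizing k with
  | _ l ih =>
    rw [monicOrtho, sub_mul, map_sub, Finset.sum_mul, map_sum,
      Finset.sum_eq_single (⟨k, hk⟩ : Fin l)]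
    · rw [mul_assoc, hw.integral_C_mul, hw.weightedInner_eq, hw.weightedInner_eq,
        div_mul_cancel₀ _ (hw.integral_mul_self_pos (monicOrtho_monic w k).ne_zero).ne', sub_self]
    · intro j _ hj
      rw [mul_assoc, hw.integral_C_mul]
      have hjk : (j : ℕ) ≠ k := fun h => hj (Fin.ext h)
      rcases hjk.lt_or_gt with h | h
      · rw [mul_comm (monicOrtho w j), ih k hk j h, mul_zero]
      · rw [ih j j.isLt k h, mul_zero]
    · simp

theorem integral_monicOrtho_mul_eq_zero (hw : IsRegularWeight w)
    {l : ℕ} {p : ℝ[X]} (hp : p.degree < l) :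
    hw.integral (monicOrtho w l * p) = 0 := by
  -- The degree bound is decoupled from `l`, so that induction can strip the leading term of `p` by
  -- a multiple of `monicOrtho w n` while `l` stays fixed.
  suffices H : ∀ n ≤ l, ∀ p : ℝ[X], p.degree < n → hw.integral (monicOrtho w l * p) = 0 from
    H l le_rfl p hp
  intro n
  induction n with
  | zero =>
    intro _ p hp
    have : p = 0 := by simpa using hp
    simp [this]
  | succ n ih =>
    intro hn p hp
    have h1 := ih (by omega) _ (degree_sub_C_mul_lt hp (degree_monicOrtho w n))
    rw [mul_sub, map_sub, mul_left_comm, hw.integral_C_mul,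
      hw.integral_monicOrtho_mul_monicOrtho l n (by omega), mul_zero, sub_zero] at h1
    exact h1

theorem normalization_pos (hw : IsRegularWeight w) (l : ℕ) :
    0 < 1 / √(weightedInner w (monicOrtho w l) (monicOrtho w l)) := by
  rw [hw.weightedInner_eq]
  have := hw.integral_mul_self_pos (monicOrtho_monic w l).ne_zero
  positivity

theorem degree_orthonormalPoly (hw : IsRegularWeight w)
    (l : ℕ) : (orthonormalPoly w l).degree = l := by
  rw [orthonormalPoly, degree_C_mul (hw.normalization_pos l).ne', degree_monicOrtho]

theorem natDegree_orthonormalPoly (hw : IsRegularWeight w)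
    (l : ℕ) : (orthonormalPoly w l).natDegree = l :=
  natDegree_eq_of_degree_eq_some (hw.degree_orthonormalPoly l)

theorem orthonormalPoly_ne_zero (hw : IsRegularWeight w) (l : ℕ) : orthonormalPoly w l ≠ 0 := by
  intro h
  have := hw.degree_orthonormalPoly l
  simp [h] at this

theorem leadingCoeff_orthonormalPoly_pos (hw : IsRegularWeight w)
    (l : ℕ) : 0 < (orthonormalPoly w l).leadingCoeff := by
  rw [orthonormalPoly, leadingCoeff_mul, leadingCoeff_C, (monicOrtho_monic w l).leadingCoeff,
    mul_one]
  exact hw.normalization_pos l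

theorem integral_orthonormalPoly_mul_eq_zero (hw : IsRegularWeight w)
    {l : ℕ} {p : ℝ[X]} (hp : p.degree < l) :
    hw.integral (orthonormalPoly w l * p) = 0 := by
  rw [orthonormalPoly, mul_assoc, hw.integral_C_mul, hw.integral_monicOrtho_mul_eq_zero hp,
    mul_zero]

theorem integral_orthonormalPoly_mul_self (hw : IsRegularWeight w) (l : ℕ) :
    hw.integral (orthonormalPoly w l * orthonormalPoly w l) = 1 := by
  have h := hw.integral_mul_self_pos (monicOrtho_monic w l).ne_zero
  rw [orthonormalPoly, hw.weightedInner_eq, mul_assoc, hw.integral_C_mul, mul_left_comm,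
    hw.integral_C_mul]
  have h2 := Real.mul_self_sqrt h.le
  have h3 : 0 < √(hw.integral (monicOrtho w l * monicOrtho w l)) := Real.sqrt_pos.2 h
  field_simp
  rw [sq, h2]

theorem integral_orthonormalPoly_mul (hw : IsRegularWeight w) (k l : ℕ) :
    hw.integral (orthonormalPoly w k * orthonormalPoly w l) = if k = l then 1 else 0 := by
  split_ifs with h
  · rw [h, hw.integral_orthonormalPoly_mul_self]
  · rcases lt_or_gt_of_ne h with h | h
    · rw [mul_comm, hw.integral_orthonormalPoly_mul_eq_zero]
      rw [hw.degree_orthonormalPoly]; exact_mod_cast h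
    · rw [hw.integral_orthonormalPoly_mul_eq_zero]
      rw [hw.degree_orthonormalPoly]; exact_mod_cast h

/-- A polynomial of degree less than `n` that is orthogonal to the first `n` orthonormal
polynomials vanishes. -/
theorem eq_zero_of_forall_integral_eq_zero (hw : IsRegularWeight w)
    {n : ℕ} {p : ℝ[X]} (hp : p.degree < n)
    (h : ∀ k < n, hw.integral (p * orthonormalPoly w k) = 0) : p = 0 := by
  suffices H : ∀ m ≤ n, ∀ q : ℝ[X], q.degree < m → hw.integral (p * q) = 0 from
    hw.eq_zero_of_integral_mul_self (H n le_rfl p hp)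
  intro m
  induction m with
  | zero =>
    intro _ q hq
    have : q = 0 := by simpa using hq
    simp [this]
  | succ m ih =>
    intro hm q hq
    have h1 := ih (by omega) _ (degree_sub_C_mul_lt hq (hw.degree_orthonormalPoly m))
    rwa [mul_sub, map_sub, mul_left_comm, hw.integral_C_mul, h m (by omega), mul_zero,
      sub_zero] at h1

/-- The orthonormal polynomials are characterized by their degree, orthogonality to the
polynomials of lower degree, norm one, and positive leading coefficient. -/
theorem eq_orthonormalPoly (hw : IsRegularWeight w) {l : ℕ} {p : ℝ[X]} (hdeg : p.degree = l)
    (hlc : 0 < p.leadingCoeff)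
    (horth : ∀ q : ℝ[X], q.degree < l → hw.integral (p * q) = 0)
    (hnorm : hw.integral (p * p) = 1) : p = orthonormalPoly w l := by
  have hlt : p.degree < (l + 1 : ℕ) := by rw [hdeg]; exact_mod_cast l.lt_succ_self
  have hr := degree_sub_C_mul_lt hlt (hw.degree_orthonormalPoly l)
  set c := p.coeff l / (orthonormalPoly w l).leadingCoeff with hc
  have hcpos : 0 < c := by
    rw [hc]
    refine div_pos ?_ (hw.leadingCoeff_orthonormalPoly_pos l)
    rwa [leadingCoeff, natDegree_eq_of_degree_eq_some hdeg] at hlc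
  have hz : p - C c * orthonormalPoly w l = 0 := by
    apply hw.eq_zero_of_integral_mul_self
    rw [sub_mul, map_sub, horth _ hr, mul_assoc, hw.integral_C_mul,
      hw.integral_orthonormalPoly_mul_eq_zero hr, mul_zero, sub_zero]
  have hp : p = C c * orthonormalPoly w l := sub_eq_zero.1 hz
  have hc2 : c * c = 1 := by
    rw [hp, mul_assoc, hw.integral_C_mul, mul_left_comm, hw.integral_C_mul,
      hw.integral_orthonormalPoly_mul_self, mul_one] at hnorm
    exact hnorm
  have : c = 1 := by nlinarith
  rw [hp, this, C_1, one_mul]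

theorem recA_eq (hw : IsRegularWeight w) (l : ℕ) :
    recA w l = hw.integral (X * orthonormalPoly w l * orthonormalPoly w l) :=
  hw.weightedInner_eq _ _

theorem recB_succ_eq (hw : IsRegularWeight w) (l : ℕ) :
    recB w (l + 1) = hw.integral (X * orthonormalPoly w l * orthonormalPoly w (l + 1)) :=
  hw.weightedInner_eq _ _

/-- Subtracting from `x p_l` the multiple of `p_{l+1}` with the same leading coefficient leaves a
polynomial of degree at most `l`, which is orthogonal to `p_{l+1}`. Positivity of the `b_l` follows.
-/
theorem recB_succ_eq_div (hw : IsRegularWeight w) (l : ℕ) :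
    recB w (l + 1) =
      (orthonormalPoly w l).leadingCoeff / (orthonormalPoly w (l + 1)).leadingCoeff := by
  have hdeg : (X * orthonormalPoly w l).degree = ((l + 1 : ℕ) : WithBot ℕ) := by
    rw [degree_mul, degree_X, hw.degree_orthonormalPoly, add_comm]; rfl
  have hlt : (X * orthonormalPoly w l).degree < ((l + 1 + 1 : ℕ) : WithBot ℕ) := by
    rw [hdeg]; exact_mod_cast (l + 1).lt_succ_self
  have hr := degree_sub_C_mul_lt hlt (hw.degree_orthonormalPoly (l + 1))
  have h := hw.integral_orthonormalPoly_mul_eq_zero hr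
  rw [mul_sub, map_sub, mul_left_comm _ (C _), hw.integral_C_mul,
    hw.integral_orthonormalPoly_mul_self, mul_comm (orthonormalPoly w (l + 1)), ← recB_succ_eq, mul_one, coeff_X_mul] at h
  rw [sub_eq_zero.1 h, leadingCoeff, leadingCoeff, hw.natDegree_orthonormalPoly,
      hw.natDegree_orthonormalPoly]

theorem recB_pos (hw : IsRegularWeight w) (l : ℕ) : 0 < recB w l := by
  cases l with
  | zero =>
    rw [recB, hw.weightedInner_eq]
    exact Real.sqrt_pos.2 (hw.integral_mul_self_pos one_ne_zero)
  | succ l =>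
    rw [hw.recB_succ_eq_div]
    exact div_pos (hw.leadingCoeff_orthonormalPoly_pos _) (hw.leadingCoeff_orthonormalPoly_pos _)

theorem integral_X_mul_orthonormalPoly_mul_eq_zero (hw : IsRegularWeight w)
    {l k : ℕ} (hk : k + 1 < l) :
    hw.integral (X * orthonormalPoly w l * orthonormalPoly w k) = 0 := by
  rw [mul_comm X, mul_assoc, hw.integral_orthonormalPoly_mul_eq_zero]
  rw [degree_mul, degree_X, hw.degree_orthonormalPoly, add_comm]
  exact_mod_cast hk

/-- The three-term recurrence for the first two orthonormal polynomials. -/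
theorem X_mul_orthonormalPoly_zero (hw : IsRegularWeight w) :
    X * orthonormalPoly w 0 =
      C (recB w 1) * orthonormalPoly w 1 + C (recA w 0) * orthonormalPoly w 0 := by
  rw [← sub_eq_zero]
  refine hw.eq_zero_of_forall_integral_eq_zero (n := 2) ?_ ?_
  · rw [← mem_degreeLT]
    refine Submodule.sub_mem _ ?_ (Submodule.add_mem _ ?_ ?_)
    · rw [mem_degreeLT, degree_mul, degree_X, hw.degree_orthonormalPoly]; norm_num
    · rw [← smul_eq_C_mul]
      refine Submodule.smul_mem _ _ ?_
      rw [mem_degreeLT, hw.degree_orthonormalPoly]; norm_num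
    · rw [← smul_eq_C_mul]
      refine Submodule.smul_mem _ _ ?_
      rw [mem_degreeLT, hw.degree_orthonormalPoly]; norm_num
  · intro k hk
    rw [sub_mul, add_mul, map_sub, map_add, mul_assoc (C _), hw.integral_C_mul, mul_assoc (C _),
      hw.integral_C_mul, hw.integral_orthonormalPoly_mul, hw.integral_orthonormalPoly_mul]
    interval_cases k
    · simp [hw.recA_eq]
    · simp [hw.recB_succ_eq]

/-- The three-term recurrence of the orthonormal polynomials. -/
theorem X_mul_orthonormalPoly_succ (hw : IsRegularWeight w) (l : ℕ) :
    X * orthonormalPoly w (l + 1) =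
      C (recB w (l + 2)) * orthonormalPoly w (l + 2) + C (recA w (l + 1)) * orthonormalPoly w (l + 1)
        + C (recB w (l + 1)) * orthonormalPoly w l := by
  rw [← sub_eq_zero]
  refine hw.eq_zero_of_forall_integral_eq_zero (n := l + 3) ?_ ?_
  · have key : ∀ (c : ℝ) (k : ℕ), k < l + 3 →
        C c * orthonormalPoly w k ∈ degreeLT ℝ (l + 3) := by
      intro c k hk
      rw [← smul_eq_C_mul]
      refine Submodule.smul_mem _ _ ?_
      rw [mem_degreeLT, hw.degree_orthonormalPoly]
      exact_mod_cast hk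
    rw [← mem_degreeLT]
    refine Submodule.sub_mem _ ?_ (Submodule.add_mem _ (Submodule.add_mem _ ?_ ?_) ?_)
    · rw [mem_degreeLT, degree_mul, degree_X, hw.degree_orthonormalPoly, add_comm]
      exact_mod_cast (by omega : l + 1 + 1 < l + 3)
    all_goals exact key _ _ (by omega)
  · intro k hk
    simp only [sub_mul, add_mul, map_sub, map_add, mul_assoc (C _), hw.integral_C_mul,
      hw.integral_orthonormalPoly_mul]
    rcases Nat.lt_or_ge k l with h | h
    · rw [hw.integral_X_mul_orthonormalPoly_mul_eq_zero (by omega)]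
      simp [show l + 2 ≠ k by omega, show l + 1 ≠ k by omega, show l ≠ k by omega]
    · obtain rfl | rfl | rfl : k = l ∨ k = l + 1 ∨ k = l + 2 := by omega
      · rw [mul_assoc, mul_comm (orthonormalPoly w (k + 1)), ← mul_assoc, ← recB_succ_eq]
        simp
      · simp [hw.recA_eq]
      · simp [hw.recB_succ_eq (l + 1)]

end IsRegularWeight

end OptHermite

/-! ### The Hermite weight, and the Laguerre weight as its image under `t = x²`. -/

namespace OptHermite

open MeasureTheory

theorem hermiteWeight_pos (x : ℝ) : 0 < hermiteWeight x := Real.exp_pos _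

theorem continuous_hermiteWeight : Continuous hermiteWeight := by
  unfold hermiteWeight
  fun_prop

theorem integrable_eval_mul_hermiteWeight (p : ℝ[X]) :
    Integrable fun x => p.eval x * hermiteWeight x := by
  induction p using Polynomial.induction_on' with
  | add p q hp hq =>
    simp only [eval_add, add_mul]
    exact hp.add hq
  | monomial n a =>
    have h := integrable_rpow_mul_exp_neg_mul_sq (b := 1) one_pos
      (s := n) (by linarith [(Nat.cast_nonneg n : (0 : ℝ) ≤ n)])
    simp only [Real.rpow_natCast, neg_mul, one_mul] at h
    simpa only [eval_monomial, mul_assoc, hermiteWeight] using h.const_mul a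

theorem isRegularWeight_hermiteWeight : IsRegularWeight hermiteWeight where
  integrable := integrable_eval_mul_hermiteWeight
  pos p hp := by
    have hnn : ∀ x, 0 ≤ (p * p).eval x * hermiteWeight x := fun x => by
      rw [eval_mul]
      exact mul_nonneg (mul_self_nonneg _) (hermiteWeight_pos x).le
    have hc : Continuous fun x => (p * p).eval x * hermiteWeight x :=
      (p * p).continuous.mul continuous_hermiteWeight
    obtain ⟨x, hx⟩ : ∃ x : ℝ, p.eval x ≠ 0 := by
      by_contra! h
      exact hp (Polynomial.funext fun x => by simpa using h x)
    rw [integral_pos_iff_support_of_nonneg hnn (integrable_eval_mul_hermiteWeight _)]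
    refine hc.isOpen_support.measure_pos volume ⟨x, ?_⟩
    rw [Function.mem_support, eval_mul]
    exact mul_ne_zero (mul_ne_zero hx hx) (hermiteWeight_pos x).ne'

/-- Integration by parts for the Hermite weight. -/
theorem integral_derivative_hermiteWeight (p : ℝ[X]) :
    isRegularWeight_hermiteWeight.integral (derivative p) =
      2 * isRegularWeight_hermiteWeight.integral (X * p) := by
  have hd : ∀ x, HasDerivAt (fun x => p.eval x * hermiteWeight x)
      ((derivative p - C 2 * (X * p)).eval x * hermiteWeight x) x := fun x => by
    have h1 : HasDerivAt hermiteWeight (Real.exp (-x ^ 2) * (-(2 * x))) x := by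
      have := ((hasDerivAt_pow 2 x).neg).exp
      simpa [hermiteWeight] using! this
    refine ((p.hasDerivAt x).mul h1).congr_deriv ?_
    simp only [eval_sub, eval_mul, eval_C, eval_X, hermiteWeight]
    ring
  have h := integral_eq_zero_of_hasDerivAt_of_integrable hd
    (integrable_eval_mul_hermiteWeight _) (integrable_eval_mul_hermiteWeight _)
  rw [← isRegularWeight_hermiteWeight.integral_apply, map_sub,
    isRegularWeight_hermiteWeight.integral_C_mul] at h
  linarith

/-- Integrate `(h_l²)'` by parts: `h_l'` has lower degree than `h_l`, so the integral of `h_l h_l'`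
vanishes. -/
theorem recA_hermiteWeight (l : ℕ) : recA hermiteWeight l = 0 := by
  have hw := isRegularWeight_hermiteWeight
  have h := integral_derivative_hermiteWeight
    (orthonormalPoly hermiteWeight l * orthonormalPoly hermiteWeight l)
  have hlt : (derivative (orthonormalPoly hermiteWeight l)).degree < l := by
    rw [← hw.degree_orthonormalPoly l]
    exact degree_derivative_lt (hw.orthonormalPoly_ne_zero l)
  rw [derivative_mul, map_add, mul_comm (derivative _),
    hw.integral_orthonormalPoly_mul_eq_zero hlt, ← mul_assoc, ← hw.recA_eq] at h
  linarith

/-- Integrate `(h_l h_{l+1})'` by parts. Only `h_l h_{l+1}'` contributes, and comparing leading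
coefficients gives `(l + 1) / b_{l+1}` for it; the other side is `2 b_{l+1}`. -/
theorem recB_hermiteWeight_sq (l : ℕ) : recB hermiteWeight (l + 1) ^ 2 = (l + 1) / 2 := by
  have hw := isRegularWeight_hermiteWeight
  set h₀ := orthonormalPoly hermiteWeight l with hh₀
  set h₁ := orthonormalPoly hermiteWeight (l + 1) with hh₁
  have h := integral_derivative_hermiteWeight (h₀ * h₁)
  have hlt₀ : (derivative h₀).degree < (l + 1 : ℕ) := by
    refine (degree_derivative_lt (hw.orthonormalPoly_ne_zero l)).trans ?_
    rw [hw.degree_orthonormalPoly]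
    exact_mod_cast l.lt_succ_self
  have hlt₁ : (derivative h₁).degree < (l + 1 : ℕ) := by
    rw [← hw.degree_orthonormalPoly (l + 1)]
    exact degree_derivative_lt (hw.orthonormalPoly_ne_zero (l + 1))
  have hr := hw.integral_orthonormalPoly_mul_eq_zero
    (degree_sub_C_mul_lt hlt₁ (hw.degree_orthonormalPoly l))
  rw [mul_sub, map_sub, mul_left_comm, hw.integral_C_mul, hw.integral_orthonormalPoly_mul_self,
    mul_one, coeff_derivative, sub_eq_zero] at hr
  rw [derivative_mul, map_add, mul_comm (derivative _),
    hw.integral_orthonormalPoly_mul_eq_zero hlt₀, zero_add, hr, ← mul_assoc,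
    ← hw.recB_succ_eq] at h
  have hb := hw.recB_succ_eq_div l
  have hp₀ := hw.leadingCoeff_orthonormalPoly_pos l
  have hp₁ := hw.leadingCoeff_orthonormalPoly_pos (l + 1)
  have hc : (orthonormalPoly hermiteWeight (l + 1)).coeff (l + 1) =
      (orthonormalPoly hermiteWeight (l + 1)).leadingCoeff := by
    rw [leadingCoeff, hw.natDegree_orthonormalPoly]
  rw [hh₁, hc] at h
  rw [hb] at h ⊢
  field_simp at h ⊢
  linarith

/-- The recurrence coefficients `√(l / 2)` of the orthonormal Hermite polynomials. -/
noncomputable def hermiteB (l : ℕ) : ℝ := √(l / 2)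

theorem hermiteB_sq (l : ℕ) : hermiteB l ^ 2 = l / 2 := Real.sq_sqrt (by positivity)

/-- Here `hermiteB` departs from `recB hermiteWeight`, whose value at 0 is the norm of the constant
1. -/
theorem hermiteB_zero : hermiteB 0 = 0 := by simp [hermiteB]

theorem hermiteB_pos {l : ℕ} (hl : 0 < l) : 0 < hermiteB l := by
  unfold hermiteB
  positivity

theorem recB_hermiteWeight (l : ℕ) : recB hermiteWeight (l + 1) = hermiteB (l + 1) := by
  rw [hermiteB, eq_comm, Real.sqrt_eq_iff_eq_sq (by positivity)
    (isRegularWeight_hermiteWeight.recB_pos _).le, recB_hermiteWeight_sq]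
  push_cast
  rfl

theorem X_mul_hermiteON_zero : X * hermiteON 0 = C (hermiteB 1) * hermiteON 1 := by
  have := isRegularWeight_hermiteWeight.X_mul_orthonormalPoly_zero
  rw [recA_hermiteWeight, recB_hermiteWeight] at this
  simpa [hermiteON] using this

theorem X_mul_hermiteON_succ (l : ℕ) :
    X * hermiteON (l + 1) =
      C (hermiteB (l + 2)) * hermiteON (l + 2) + C (hermiteB (l + 1)) * hermiteON l := by
  have := isRegularWeight_hermiteWeight.X_mul_orthonormalPoly_succ l
  rw [recA_hermiteWeight, recB_hermiteWeight, recB_hermiteWeight] at this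
  simpa [hermiteON] using this

theorem integral_hermiteON_mul (k l : ℕ) :
    isRegularWeight_hermiteWeight.integral (hermiteON k * hermiteON l) = if k = l then 1 else 0 :=
  isRegularWeight_hermiteWeight.integral_orthonormalPoly_mul k l

theorem integral_comp_neg_X_hermiteWeight (p : ℝ[X]) :
    isRegularWeight_hermiteWeight.integral (p.comp (-X)) =
      isRegularWeight_hermiteWeight.integral p := by
  rw [IsRegularWeight.integral_apply, IsRegularWeight.integral_apply,
    ← integral_neg_eq_self]
  simp [eval_comp, hermiteWeight]

theorem sq_rpow_neg_one_div_two {x : ℝ} (hx : 0 < x) : (x ^ 2) ^ (-1 / 2 : ℝ) = x⁻¹ := by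
  rw [← Real.rpow_natCast, ← Real.rpow_mul hx.le]
  norm_num [Real.rpow_neg_one]

/-- The substitution `t = x²`. -/
theorem integral_mul_laguerreWeight (f : ℝ → ℝ) :
    ∫ x, f x * laguerreWeight (-1 / 2) x = ∫ x, f (x ^ 2) * hermiteWeight x := by
  have h1 : ∫ x, f (x ^ 2) * hermiteWeight x =
      2 * ∫ x in Set.Ioi (0 : ℝ), f (x ^ 2) * hermiteWeight x := by
    rw [← integral_comp_abs]
    simp [hermiteWeight]
  have h2 : ∀ x, f x * laguerreWeight (-1 / 2) x =
      (Set.Ioi (0 : ℝ)).indicator (fun x => f x * (x ^ (-1 / 2 : ℝ) * Real.exp (-x))) x := by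
    intro x
    simp only [laguerreWeight, Set.indicator_apply, mul_ite, mul_zero]
  simp_rw [h2]
  rw [h1, integral_indicator measurableSet_Ioi, ← integral_comp_rpow_Ioi_of_pos two_pos,
    ← integral_const_mul]
  refine setIntegral_congr_fun measurableSet_Ioi fun x hx => ?_
  have hx : 0 < x := hx
  simp only [sq_rpow_neg_one_div_two hx, smul_eq_mul, Real.rpow_two, hermiteWeight]
  norm_num
  field_simp

theorem integrable_eval_mul_laguerreWeight (p : ℝ[X]) :
    Integrable fun x => p.eval x * laguerreWeight (-1 / 2) x := by
  have h2 : (fun x => p.eval x * laguerreWeight (-1 / 2) x) =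
      (Set.Ioi (0 : ℝ)).indicator
        (fun x => p.eval x * (x ^ (-1 / 2 : ℝ) * Real.exp (-x))) := by
    funext x
    simp only [laguerreWeight, Set.indicator_apply, mul_ite, mul_zero]
  rw [h2, integrable_indicator_iff measurableSet_Ioi,
    -- The substitution `t = x²` removes the singularity `t^(-1/2)` at the origin.
    ← integrableOn_Ioi_comp_rpow_iff' _ two_ne_zero]
  have := (integrable_eval_mul_hermiteWeight (p.comp (X ^ 2))).integrableOn (s := Set.Ioi 0)
  refine this.congr_fun (fun x hx => ?_) measurableSet_Ioi
  have hx : 0 < x := hx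
  simp only [sq_rpow_neg_one_div_two hx, smul_eq_mul, hermiteWeight, eval_comp, eval_pow, eval_X, Real.rpow_two]
  norm_num
  field_simp

theorem isRegularWeight_laguerreWeight : IsRegularWeight (laguerreWeight (-1 / 2)) where
  integrable := integrable_eval_mul_laguerreWeight
  pos p hp := by
    rw [integral_mul_laguerreWeight fun x => (p * p).eval x]
    have hne : p.comp (X ^ 2) ≠ 0 := by
      rw [Ne, ← expand_eq_comp_X_pow, expand_eq_zero two_pos]
      exact hp
    have := isRegularWeight_hermiteWeight.pos _ hne
    simpa [eval_comp] using this

theorem integral_laguerreWeight (p : ℝ[X]) :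
    isRegularWeight_laguerreWeight.integral p =
      isRegularWeight_hermiteWeight.integral (p.comp (X ^ 2)) := by
  rw [IsRegularWeight.integral_apply, IsRegularWeight.integral_apply,
    integral_mul_laguerreWeight fun x => p.eval x]
  simp [eval_comp]

/-- The Hermite polynomials of even degree are Laguerre polynomials in `x²`. -/
theorem laguerreON_comp_X_sq (l : ℕ) : (laguerreON (-1 / 2) l).comp (X ^ 2) = hermiteON (2 * l) := by
  have hL := isRegularWeight_laguerreWeight
  have hH := isRegularWeight_hermiteWeight
  set p := laguerreON (-1 / 2) l with hp
  have hdeg : p.natDegree = l := hL.natDegree_orthonormalPoly l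
  have hp0 : p ≠ 0 := hL.orthonormalPoly_ne_zero l
  have hcomp0 : p.comp (X ^ 2) ≠ 0 := by
    rwa [Ne, ← expand_eq_comp_X_pow, expand_eq_zero two_pos]
  -- Orthogonality is tested on monomials: even powers transfer to the Laguerre weight, odd powers
  -- give an odd integrand.
  have hmono : ∀ j < 2 * l, hH.integral (p.comp (X ^ 2) * X ^ j) = 0 := by
    intro j hj
    rcases Nat.even_or_odd' j with ⟨i, rfl | rfl⟩
    · have : p.comp (X ^ 2) * X ^ (2 * i) = (p * X ^ i).comp (X ^ 2) := by
        simp [pow_mul]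
      rw [this, ← integral_laguerreWeight, hp, laguerreON,
        hL.integral_orthonormalPoly_mul_eq_zero]
      rw [degree_X_pow]
      exact_mod_cast (by omega : i < l)
    · have h := integral_comp_neg_X_hermiteWeight (p.comp (X ^ 2) * X ^ (2 * i + 1))
      have h2 : (p.comp (X ^ 2) * X ^ (2 * i + 1)).comp (-X) =
          -(p.comp (X ^ 2) * X ^ (2 * i + 1)) := by
        rw [mul_comp, comp_assoc, X_pow_comp, X_pow_comp, neg_sq, Odd.neg_pow ⟨i, rfl⟩]
        ring
      rw [h2, map_neg] at h
      linarith
  refine hH.eq_orthonormalPoly ?_ ?_ ?_ ?_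
  · rw [degree_eq_natDegree hcomp0, natDegree_comp, hdeg, natDegree_X_pow, mul_comm]
  · rw [leadingCoeff_comp (by simp)]
    simpa [hp, laguerreON] using hL.leadingCoeff_orthonormalPoly_pos l
  · intro q hq
    rcases eq_or_ne q 0 with rfl | hq0
    · simp
    have hqd : q.natDegree < 2 * l := (natDegree_lt_iff_degree_lt hq0).2 hq
    rw [q.as_sum_range_C_mul_X_pow' hqd, Finset.mul_sum, map_sum]
    refine Finset.sum_eq_zero fun j hj => ?_
    rw [mul_left_comm, hH.integral_C_mul, hmono j (Finset.mem_range.1 hj), mul_zero]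
  · rw [← mul_comp, ← integral_laguerreWeight]
    exact hL.integral_orthonormalPoly_mul_self l

/-- This and the next two identities apply the Hermite recurrence twice; the diagonal constants are
sums of squares of `hermiteB`. -/
theorem X_sq_mul_hermiteON_zero :
    X ^ 2 * hermiteON 0 = C (hermiteB 1 * hermiteB 2) * hermiteON 2
      + C (1 / 2) * hermiteON 0 := by
  have h : C (1 / 2 : ℝ) = C (hermiteB 1) ^ 2 := by
    rw [← C_pow, hermiteB_sq]; norm_num
  rw [h, C_mul]
  linear_combination X * X_mul_hermiteON_zero + C (hermiteB 1) * X_mul_hermiteON_succ 0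

theorem X_sq_mul_hermiteON_one :
    X ^ 2 * hermiteON 1 = C (hermiteB 2 * hermiteB 3) * hermiteON 3
      + C (3 / 2) * hermiteON 1 := by
  have h : C (3 / 2 : ℝ) = C (hermiteB 1) ^ 2 + C (hermiteB 2) ^ 2 := by
    rw [← C_pow, ← C_pow, ← C_add, hermiteB_sq, hermiteB_sq]; norm_num
  rw [h, C_mul]
  linear_combination X * X_mul_hermiteON_succ 0 + C (hermiteB 2) * X_mul_hermiteON_succ 1 +
    C (hermiteB 1) * X_mul_hermiteON_zero

theorem X_sq_mul_hermiteON (l : ℕ) :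
    X ^ 2 * hermiteON (l + 2) = C (hermiteB (l + 3) * hermiteB (l + 4)) * hermiteON (l + 4)
      + C (l + 2 + 1 / 2 : ℝ) * hermiteON (l + 2)
      + C (hermiteB (l + 1) * hermiteB (l + 2)) * hermiteON l := by
  have h : C (l + 2 + 1 / 2 : ℝ) = C (hermiteB (l + 2)) ^ 2 + C (hermiteB (l + 3)) ^ 2 := by
    rw [← C_pow, ← C_pow, ← C_add, hermiteB_sq, hermiteB_sq]
    congr 1
    push_cast
    ring
  rw [h, C_mul, C_mul]
  linear_combination X * X_mul_hermiteON_succ (l + 1) +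
    C (hermiteB (l + 3)) * X_mul_hermiteON_succ (l + 2) +
    C (hermiteB (l + 2)) * X_mul_hermiteON_succ l

end OptHermite

/-! ### Truncated Jacobi matrices: least eigenvalue, eigenvectors, comparison. -/

namespace OptHermite

open Finset in
/-- The quadratic form of the truncated Jacobi matrix of size `N` with diagonal `a 0, a 1, …` and
off-diagonal `b 1, b 2, …`. -/
def jacobiForm (a b : ℕ → ℝ) (N : ℕ) (d : ℕ → ℝ) : ℝ :=
  ∑ l ∈ range N, a l * d l ^ 2 + 2 * ∑ l ∈ range (N - 1), b (l + 1) * (d l * d (l + 1))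

open Finset in
/-- The bilinear form of the truncated Jacobi matrix. -/
def jacobiBilin (a b : ℕ → ℝ) (N : ℕ) (d e : ℕ → ℝ) : ℝ :=
  ∑ l ∈ range N, a l * (d l * e l) +
    ∑ l ∈ range (N - 1), b (l + 1) * (d l * e (l + 1) + d (l + 1) * e l)

/-- The truncated Jacobi matrix of size `M + 1`, applied to the sequence `d`. -/
def jacobiMul (a b : ℕ → ℝ) (M : ℕ) (d : ℕ → ℝ) (l : ℕ) : ℝ :=
  a l * d l + (if l < M then b (l + 1) * d (l + 1) else 0) + (if 0 < l then b l * d (l - 1) else 0)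

/-- The solution of the three-term recurrence with coefficients `a`, `b` and initial value `1`. -/
noncomputable def jacobiSol (a b : ℕ → ℝ) (x : ℝ) : ℕ → ℝ
  | 0 => 1
  | 1 => (b 1)⁻¹ * (x - a 0)
  | l + 2 => (b (l + 2))⁻¹ * ((x - a (l + 1)) * jacobiSol a b x (l + 1)
      - b (l + 1) * jacobiSol a b x l)

section Jacobi

open Finset

variable {a b : ℕ → ℝ} {M : ℕ}

theorem jacobiBilin_self (a b : ℕ → ℝ) (N : ℕ) (d : ℕ → ℝ) :
    jacobiBilin a b N d d = jacobiForm a b N d := by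
  unfold jacobiBilin jacobiForm
  rw [mul_sum]
  congr 1
  · exact sum_congr rfl fun l _ => by ring
  · exact sum_congr rfl fun l _ => by ring

theorem jacobiForm_add_mul (a b : ℕ → ℝ) (N : ℕ) (d e : ℕ → ℝ) (t : ℝ) :
    jacobiForm a b N (fun l => d l + t * e l) =
      jacobiForm a b N d + 2 * t * jacobiBilin a b N d e + t ^ 2 * jacobiForm a b N e := by
  simp only [jacobiForm, jacobiBilin, mul_add, mul_sum]
  have key : ∀ A B C D A' B' C' D' : ℝ, A = C + A' + B' → B = D + C' + D' →
      A + B = C + D + (A' + C') + (B' + D') := by intros; linarith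
  refine key _ _ _ _ _ _ _ _ ?_ ?_
  · rw [← sum_add_distrib, ← sum_add_distrib]
    exact sum_congr rfl fun l _ => by ring
  · rw [← sum_add_distrib, ← sum_add_distrib]
    exact sum_congr rfl fun l _ => by ring

theorem jacobiForm_mul (a b : ℕ → ℝ) (N : ℕ) (d : ℕ → ℝ) (t : ℝ) :
    jacobiForm a b N (fun l => t * d l) = t ^ 2 * jacobiForm a b N d := by
  simp only [jacobiForm, mul_add, mul_sum]
  congr 1
  · exact sum_congr rfl fun l _ => by ring
  · exact sum_congr rfl fun l _ => by ring

theorem jacobiForm_congr (a b : ℕ → ℝ) {N : ℕ} {d e : ℕ → ℝ} (h : ∀ l < N, d l = e l) :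
    jacobiForm a b N d = jacobiForm a b N e := by
  unfold jacobiForm
  congr 1
  · exact sum_congr rfl fun l hl => by rw [h l (mem_range.1 hl)]
  · congr 1
    refine sum_congr rfl fun l hl => ?_
    have := mem_range.1 hl
    rw [h l (by omega), h (l + 1) (by omega)]

theorem jacobiBilin_eq_sum (a b : ℕ → ℝ) (M : ℕ) (d e : ℕ → ℝ) :
    jacobiBilin a b (M + 1) d e = ∑ l ∈ range (M + 1), jacobiMul a b M d l * e l := by
  have h1 : ∑ l ∈ range (M + 1), (if l < M then b (l + 1) * d (l + 1) else 0) * e l =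
      ∑ l ∈ range M, b (l + 1) * (d (l + 1) * e l) := by
    rw [sum_range_succ, if_neg (lt_irrefl M), zero_mul, add_zero]
    refine sum_congr rfl fun l hl => ?_
    rw [if_pos (mem_range.1 hl), mul_assoc]
  have h2 : ∑ l ∈ range (M + 1), (if 0 < l then b l * d (l - 1) else 0) * e l =
      ∑ l ∈ range M, b (l + 1) * (d l * e (l + 1)) := by
    rw [sum_range_succ', if_neg (lt_irrefl 0), zero_mul, add_zero]
    refine sum_congr rfl fun l _ => ?_
    rw [if_pos l.succ_pos, Nat.add_sub_cancel, mul_assoc]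
  simp only [jacobiMul, add_mul, sum_add_distrib, h1, h2]
  simp only [jacobiBilin, Nat.add_sub_cancel, mul_add, sum_add_distrib, mul_assoc]
  ring

/-- The recurrence is the eigenvalue equation row by row. Truncation spoils only the last row, and
the defect vanishes exactly when `x` is a zero of the next solution entry. -/
theorem jacobiMul_jacobiSol (hb : ∀ l, 0 < b (l + 1)) (x : ℝ) {l : ℕ} (hl : l ≤ M) :
    jacobiMul a b M (jacobiSol a b x) l = x * jacobiSol a b x l -
      if l = M then b (M + 1) * jacobiSol a b x (M + 1) else 0 := by
  have h : a l * jacobiSol a b x l + b (l + 1) * jacobiSol a b x (l + 1)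
      + (if 0 < l then b l * jacobiSol a b x (l - 1) else 0) = x * jacobiSol a b x l := by
    cases l with
    | zero =>
      have := (hb 0).ne'
      rw [if_neg (lt_irrefl 0), zero_add, jacobiSol, jacobiSol, mul_inv_cancel_left₀ this]
      ring
    | succ l =>
      have := (hb (l + 1)).ne'
      rw [if_pos l.succ_pos, Nat.add_sub_cancel, jacobiSol, mul_inv_cancel_left₀ this]
      ring
  unfold jacobiMul
  rcases hl.lt_or_eq with hl | rfl
  · rw [if_pos hl, if_neg hl.ne, h, sub_zero]
  · rw [if_neg (lt_irrefl _), if_pos rfl, ← h]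
    ring

/-- Nonzero off-diagonal entries let each row determine the next entry from the two before it, so
eigenspaces are one-dimensional. -/
theorem eq_mul_jacobiSol (hb : ∀ l, 0 < b (l + 1)) {x : ℝ} {d : ℕ → ℝ}
    (h : ∀ l ≤ M, jacobiMul a b M d l = x * d l) :
    ∀ l ≤ M, d l = d 0 * jacobiSol a b x l := by
  intro l
  induction l using Nat.twoStepInduction with
  | zero => intro _; rw [jacobiSol, mul_one]
  | one =>
    intro hl
    have := h 0 (by omega)
    rw [jacobiMul, if_pos (by omega), if_neg (lt_irrefl 0)] at this
    have hb0 := (hb 0).ne'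
    rw [jacobiSol]
    rw [zero_add] at hb0 this
    field_simp
    linarith
  | more l ih₀ ih₁ =>
    intro hl
    have := h (l + 1) (by omega)
    rw [jacobiMul, if_pos (by omega), if_pos l.succ_pos, Nat.add_sub_cancel, ih₁ (by omega),
      ih₀ (by omega)] at this
    have hb0 := (hb (l + 1)).ne'
    apply mul_left_cancel₀ hb0
    rw [jacobiSol, mul_left_comm, mul_inv_cancel_left₀ hb0]
    linarith

theorem jacobiSol_succ_eq_zero (hb : ∀ l, 0 < b (l + 1)) {x : ℝ} {d : ℕ → ℝ}
    (h : ∀ l ≤ M, jacobiMul a b M d l = x * d l) (hd : d 0 ≠ 0) :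
    jacobiSol a b x (M + 1) = 0 := by
  have h1 := jacobiMul_jacobiSol (a := a) hb x (le_refl M)
  have h2 := h M le_rfl
  have h3 := eq_mul_jacobiSol hb h
  have h4 : jacobiMul a b M d M = d 0 * jacobiMul a b M (jacobiSol a b x) M := by
    simp only [jacobiMul, lt_irrefl, if_false]
    rw [h3 M le_rfl]
    split_ifs
    · rw [h3 (M - 1) (by omega)]; ring
    · ring
  rw [h4, h1, h3 M le_rfl, if_pos rfl] at h2
  have h5 : d 0 * b (M + 1) * jacobiSol a b x (M + 1) = 0 := by linarith
  exact (mul_eq_zero.1 h5).resolve_left (mul_ne_zero hd (hb M).ne')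

theorem jacobiForm_jacobiSol (hb : ∀ l, 0 < b (l + 1)) {x : ℝ}
    (hx : jacobiSol a b x (M + 1) = 0) :
    jacobiForm a b (M + 1) (jacobiSol a b x) = x * ∑ l ∈ range (M + 1), jacobiSol a b x l ^ 2 := by
  rw [← jacobiBilin_self, jacobiBilin_eq_sum, mul_sum]
  refine sum_congr rfl fun l hl => ?_
  rw [jacobiMul_jacobiSol hb x (by have := mem_range.1 hl; omega), hx]
  simp only [mul_zero, ite_self, sub_zero]
  ring

theorem sum_sq_jacobiSol_pos (a b : ℕ → ℝ) (x : ℝ) (M : ℕ) :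
    0 < ∑ l ∈ range (M + 1), jacobiSol a b x l ^ 2 := by
  rw [sum_range_succ', jacobiSol]
  have : 0 ≤ ∑ l ∈ range M, jacobiSol a b x (l + 1) ^ 2 := sum_nonneg fun _ _ => sq_nonneg _
  linarith

/-- At a zero of `jacobiSol a b · (M + 1)` the previous value does not vanish. -/
theorem jacobiSol_ne_zero (hb : ∀ l, 0 < b (l + 1)) {x : ℝ}
    (hx : jacobiSol a b x (M + 1) = 0) : jacobiSol a b x M ≠ 0 := by
  induction M with
  | zero => simp [jacobiSol]
  | succ M ih =>
    -- Two consecutive zeros would propagate down the recurrence to the initial value 1.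
    intro h
    refine ih h ?_
    rw [jacobiSol, h, mul_zero, zero_sub] at hx
    have h1 := (hb M).ne'
    have h2 := (hb (M + 1)).ne'
    simpa [h1, h2] using hx

/-- Compactness of the unit sphere gives the minimum; homogeneity of degree two extends the bound to
all vectors. -/
theorem exists_isMin_jacobiForm (a b : ℕ → ℝ) (M : ℕ) :
    ∃ (x : ℝ) (v : ℕ → ℝ), ∑ l ∈ range (M + 1), v l ^ 2 = 1 ∧ jacobiForm a b (M + 1) v = x ∧
      ∀ d, x * ∑ l ∈ range (M + 1), d l ^ 2 ≤ jacobiForm a b (M + 1) d := by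
  let ext : EuclideanSpace ℝ (Fin (M + 1)) → ℕ → ℝ := fun v l => if h : l < M + 1 then v ⟨l, h⟩ else 0
  have hext : ∀ l, Continuous fun v : EuclideanSpace ℝ (Fin (M + 1)) => ext v l := by
    intro l
    by_cases h : l < M + 1
    · simp only [ext, dif_pos h]
      fun_prop
    · simp only [ext, dif_neg h]
      fun_prop
  have hcont : Continuous fun v : EuclideanSpace ℝ (Fin (M + 1)) => jacobiForm a b (M + 1) (ext v) := by
    unfold jacobiForm
    fun_prop
  have hnorm : ∀ v : EuclideanSpace ℝ (Fin (M + 1)), ∑ l ∈ range (M + 1), ext v l ^ 2 = ‖v‖ ^ 2 := by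
    intro v
    rw [EuclideanSpace.real_norm_sq_eq, sum_range]
    exact sum_congr rfl fun i _ => by simp only [ext, dif_pos i.isLt]
  obtain ⟨v, hv, hmin⟩ := (isCompact_sphere (0 : EuclideanSpace ℝ (Fin (M + 1))) 1).exists_isMinOn
    (NormedSpace.sphere_nonempty.2 zero_le_one) hcont.continuousOn
  have hv1 : ‖v‖ = 1 := by simpa using hv
  refine ⟨_, ext v, by rw [hnorm, hv1, one_pow], rfl, fun d => ?_⟩
  let e : EuclideanSpace ℝ (Fin (M + 1)) := WithLp.toLp 2 fun i => d i
  have he : ∀ l < M + 1, ext e l = d l := fun l hl => by simp only [ext, e, dif_pos hl]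
  rw [← jacobiForm_congr a b he,
    sum_congr rfl fun l hl => by rw [← he l (mem_range.1 hl)], hnorm]
  rcases eq_or_ne e 0 with h0 | h0
  · have : ext e = fun l => 0 * ext e l := by
      funext l
      simp [h0, ext]
    rw [this, jacobiForm_mul, h0]
    simp
  · have hn : 0 < ‖e‖ := norm_pos_iff.2 h0
    have hmem : ‖e‖⁻¹ • e ∈ Metric.sphere (0 : EuclideanSpace ℝ (Fin (M + 1))) 1 := by
      simp [norm_smul, hn.ne']
    have h1 : jacobiForm a b (M + 1) (ext v) ≤ jacobiForm a b (M + 1) (ext (‖e‖⁻¹ • e)) :=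
      hmin hmem
    have h2 : ext (‖e‖⁻¹ • e) = fun l => ‖e‖⁻¹ * ext e l := by
      funext l
      simp only [ext]
      split_ifs <;> simp
    rw [h2, jacobiForm_mul, inv_pow, ← div_eq_inv_mul, le_div_iff₀ (by positivity)] at h1
    exact h1

/-- A vector at which the Rayleigh quotient is minimal is an eigenvector. -/
theorem jacobiMul_eq_of_isMin {x : ℝ} {v : ℕ → ℝ}
    (hmin : ∀ d, x * ∑ l ∈ range (M + 1), d l ^ 2 ≤ jacobiForm a b (M + 1) d)
    (hv : jacobiForm a b (M + 1) v = x * ∑ l ∈ range (M + 1), v l ^ 2) :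
    ∀ l ≤ M, jacobiMul a b M v l = x * v l := by
  -- The residual of the eigenvalue equation serves as the direction of variation: along it the
  -- first-order term is `2 t ∑ e²`, which must vanish.
  let e : ℕ → ℝ := fun l => jacobiMul a b M v l - x * v l
  have hB : jacobiBilin a b (M + 1) v e - x * ∑ l ∈ range (M + 1), v l * e l =
      ∑ l ∈ range (M + 1), e l ^ 2 := by
    rw [jacobiBilin_eq_sum, mul_sum, ← sum_sub_distrib]
    exact sum_congr rfl fun l _ => by simp only [e]; ring
  have hquad : ∀ t : ℝ, 0 ≤ 2 * t * ∑ l ∈ range (M + 1), e l ^ 2 +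
      t ^ 2 * (jacobiForm a b (M + 1) e - x * ∑ l ∈ range (M + 1), e l ^ 2) := by
    intro t
    have h1 := hmin fun l => v l + t * e l
    have h2 : ∑ l ∈ range (M + 1), (v l + t * e l) ^ 2 = ∑ l ∈ range (M + 1), v l ^ 2 +
        2 * t * ∑ l ∈ range (M + 1), v l * e l + t ^ 2 * ∑ l ∈ range (M + 1), e l ^ 2 := by
      rw [mul_sum, mul_sum, ← sum_add_distrib, ← sum_add_distrib]
      exact sum_congr rfl fun l _ => by ring
    rw [jacobiForm_add_mul, hv, h2] at h1
    rw [← hB] at *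
    nlinarith [h1]
  set S := ∑ l ∈ range (M + 1), e l ^ 2 with hS
  have hS0 : 0 ≤ S := sum_nonneg fun _ _ => sq_nonneg _
  have hSz : S = 0 := by
    by_contra hne
    have hpos : 0 < S := lt_of_le_of_ne hS0 (Ne.symm hne)
    set K := jacobiForm a b (M + 1) e - x * S with hK
    have hK0 : 0 ≤ K := by rw [hK]; linarith [hmin e]
    -- The minimum of the quadratic would be at `-S / K`; adding 1 keeps the denominator positive
    -- when `K = 0`.
    have h1 := hquad (-(S / (K + 1)))
    have h3 : 0 < K + 1 := by linarith
    have h2 : 2 * -(S / (K + 1)) * S + (-(S / (K + 1))) ^ 2 * K =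
        -(S ^ 2 * (K + 2)) / (K + 1) ^ 2 := by
      field_simp
      ring
    rw [h2] at h1
    have : -(S ^ 2 * (K + 2)) / (K + 1) ^ 2 < 0 := by
      apply div_neg_of_neg_of_pos
      · have : 0 < S ^ 2 * (K + 2) := by positivity
        linarith
      · positivity
    linarith
  intro l hl
  have := (sum_eq_zero_iff_of_nonneg fun l _ => sq_nonneg (e l)).1 hSz l
    (mem_range.2 (by omega))
  have h0 : e l = 0 := by simpa using this
  simp only [e] at h0
  linarith

/-- The minimum of the Rayleigh quotient of a truncated Jacobi matrix is the least zero of the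
corresponding orthogonal polynomial, and it is attained only at the multiples of the vector of
values of the polynomials of lower degree. -/
theorem exists_isLeast_jacobiSol (a : ℕ → ℝ) (hb : ∀ l, 0 < b (l + 1)) (M : ℕ) :
    ∃ x : ℝ, IsLeast {y | jacobiSol a b y (M + 1) = 0} x ∧
      (∀ d, x * ∑ l ∈ range (M + 1), d l ^ 2 ≤ jacobiForm a b (M + 1) d) ∧
      (∀ d, jacobiForm a b (M + 1) d = x * ∑ l ∈ range (M + 1), d l ^ 2 →
        ∀ l ≤ M, d l = d 0 * jacobiSol a b x l) := by
  obtain ⟨x, v, hv1, hvx, hmin⟩ := exists_isMin_jacobiForm a b M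
  have hmul := jacobiMul_eq_of_isMin hmin (v := v) (by rw [hv1, hvx, mul_one])
  refine ⟨x, ⟨?_, fun y hy => ?_⟩, hmin, fun d hd => eq_mul_jacobiSol hb
    (jacobiMul_eq_of_isMin hmin hd)⟩
  -- A vanishing first entry would make the whole minimizing eigenvector zero, contradicting its
  -- norm.
  · refine jacobiSol_succ_eq_zero hb hmul fun h0 => ?_
    have : ∑ l ∈ range (M + 1), v l ^ 2 = 0 := sum_eq_zero fun l hl => by
      rw [eq_mul_jacobiSol hb hmul l (by have := mem_range.1 hl; omega), h0]
      ring
    linarith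
  -- Any zero `y` is the Rayleigh quotient of its own solution vector, hence at least `x`.
  · have h1 := hmin (jacobiSol a b y)
    rw [jacobiForm_jacobiSol hb hy] at h1
    exact le_of_mul_le_mul_right h1 (sum_sq_jacobiSol_pos a b y M)

/-- Comparison of two Jacobi forms, by a discrete Hardy inequality. -/
theorem jacobiForm_le_jacobiForm {a' b' u : ℕ → ℝ} (ha : ∀ l, a l + 1 ≤ a' l)
    (hu : ∀ l, 0 < u l) (hu1 : u 0 ≤ 1)
    (hb : ∀ l, (b' (l + 1) - b (l + 1)) ^ 2 ≤ u l * (1 - u (l + 1))) (N : ℕ) (d : ℕ → ℝ) :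
    jacobiForm a b N d ≤ jacobiForm a' b' N d := by
  cases N with
  | zero => simp [jacobiForm]
  | succ N =>
    -- The surplus `u N * d N ^ 2` is carried through the induction: it pays for the next cross
    -- term, whose square is completed with what the diagonal gap 1 leaves after the new surplus is
    -- set aside.
    suffices h : jacobiForm a b (N + 1) d + u N * d N ^ 2 ≤ jacobiForm a' b' (N + 1) d by
      have := mul_nonneg (hu N).le (sq_nonneg (d N))
      linarith
    induction N with
    | zero =>
      simp only [jacobiForm, zero_add, sum_range_one, Nat.sub_self, range_zero, sum_empty]
      nlinarith [ha 0, sq_nonneg (d 0)]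
    | succ N ih =>
      have hs : ∀ a b : ℕ → ℝ, jacobiForm a b (N + 1 + 1) d = jacobiForm a b (N + 1) d +
          a (N + 1) * d (N + 1) ^ 2 + 2 * (b (N + 1) * (d N * d (N + 1))) := by
        intro a b
        simp only [jacobiForm, Nat.add_sub_cancel]
        rw [sum_range_succ _ (N + 1), sum_range_succ _ N]
        rw [sum_range_succ _ N]
        ring
      rw [hs, hs]
      have h1 := mul_le_mul_of_nonneg_right (ha (N + 1)) (sq_nonneg (d (N + 1)))
      set δ := b' (N + 1) - b (N + 1) with hδ
      have h2 : 0 ≤ u N * (u N * d N ^ 2 + (1 - u (N + 1)) * d (N + 1) ^ 2 +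
          2 * (δ * (d N * d (N + 1)))) := by
        have := mul_nonneg (sub_nonneg.2 (hb N)) (sq_nonneg (d (N + 1)))
        nlinarith [sq_nonneg (u N * d N + δ * d (N + 1))]
      have h3 := nonneg_of_mul_nonneg_right h2 (hu N)
      rw [hδ] at h3
      linarith

end Jacobi

end OptHermite

/-! ### Matrix entries of `x²` on Hermite polynomials, the Christoffel–Darboux formula, and even
versus odd degree. -/

namespace OptHermite

/-- One formula covers all `k`: where the subtraction `k - 2` truncates, that is for `k = 0` and `k
= 1`, the factor `hermiteB (k - 1)` is zero. -/
theorem X_sq_mul_hermiteON_eq (k : ℕ) :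
    X ^ 2 * hermiteON k = C (hermiteB (k + 1) * hermiteB (k + 2)) * hermiteON (k + 2)
      + C (k + 1 / 2 : ℝ) * hermiteON k
      + C (hermiteB (k - 1) * hermiteB k) * hermiteON (k - 2) := by
  match k with
  | 0 => simpa [hermiteB_zero] using X_sq_mul_hermiteON_zero
  | 1 =>
    have := X_sq_mul_hermiteON_one
    norm_num [hermiteB_zero] at this ⊢
    exact this
  | k + 2 => simpa using X_sq_mul_hermiteON k

theorem integral_X_sq_mul_hermiteON_self (k : ℕ) :
    isRegularWeight_hermiteWeight.integral (X ^ 2 * (hermiteON k * hermiteON k)) = k + 1 / 2 := by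
  rw [← mul_assoc, X_sq_mul_hermiteON_eq]
  simp only [add_mul, map_add, mul_assoc (C _), IsRegularWeight.integral_C_mul,
    integral_hermiteON_mul]
  rcases Nat.lt_or_ge k 2 with h | h
  · interval_cases k <;> simp [hermiteB_zero]
  · simp [show k - 2 ≠ k by omega]

theorem integral_X_sq_mul_hermiteON_add_two (k : ℕ) :
    isRegularWeight_hermiteWeight.integral (X ^ 2 * (hermiteON k * hermiteON (k + 2))) =
      hermiteB (k + 1) * hermiteB (k + 2) := by
  rw [← mul_assoc, X_sq_mul_hermiteON_eq]
  simp only [add_mul, map_add, mul_assoc (C _), IsRegularWeight.integral_C_mul,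
    integral_hermiteON_mul]
  simp [show k - 2 ≠ k + 2 by omega]

theorem integral_X_sq_mul_hermiteON_eq_zero {k l : ℕ} (h1 : k ≠ l) (h2 : k + 2 ≠ l)
    (h3 : l + 2 ≠ k) :
    isRegularWeight_hermiteWeight.integral (X ^ 2 * (hermiteON k * hermiteON l)) = 0 := by
  rw [← mul_assoc, X_sq_mul_hermiteON_eq]
  simp only [add_mul, map_add, mul_assoc (C _), IsRegularWeight.integral_C_mul,
    integral_hermiteON_mul]
  rw [if_neg h1, if_neg h2]
  rcases Nat.lt_or_ge k 2 with h | h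
  · interval_cases k <;> simp [hermiteB_zero]
  · simp [show k - 2 ≠ l by omega]

/-- Under `t = x²` the Laguerre entry `⟨t p_l, p_l⟩` becomes `⟨x² h_{2l}, h_{2l}⟩`; the off-diagonal
entries below transfer in the same way. -/
theorem recA_laguerreWeight (l : ℕ) : recA (laguerreWeight (-1 / 2)) l = (2 * l : ℕ) + 1 / 2 := by
  have h := laguerreON_comp_X_sq l
  rw [laguerreON] at h
  rw [isRegularWeight_laguerreWeight.recA_eq, integral_laguerreWeight, mul_assoc, mul_comp,
    mul_comp, h, X_comp, integral_X_sq_mul_hermiteON_self]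

theorem recB_laguerreWeight (l : ℕ) :
    recB (laguerreWeight (-1 / 2)) (l + 1) = hermiteB (2 * l + 1) * hermiteB (2 * l + 2) := by
  have h := laguerreON_comp_X_sq l
  have h' := laguerreON_comp_X_sq (l + 1)
  rw [laguerreON] at h h'
  rw [isRegularWeight_laguerreWeight.recB_succ_eq, integral_laguerreWeight, mul_assoc, mul_comp,
    mul_comp, h, h', X_comp, mul_add, mul_one, integral_X_sq_mul_hermiteON_add_two]

/-- The `if` encodes `h_{-2} = 0`. It is needed because the Laguerre `b_0` is a positive norm and
does not remove the term by itself. -/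
theorem X_sq_mul_hermiteON_two_mul (j : ℕ) (x : ℝ) :
    x ^ 2 * (hermiteON (2 * j)).eval x =
      recB (laguerreWeight (-1 / 2)) (j + 1) * (hermiteON (2 * (j + 1))).eval x
        + recA (laguerreWeight (-1 / 2)) j * (hermiteON (2 * j)).eval x
        + recB (laguerreWeight (-1 / 2)) j *
          (if 2 * j = 0 then 0 else (hermiteON (2 * j - 2)).eval x) := by
  have h := congrArg (eval x) (X_sq_mul_hermiteON_eq (2 * j))
  simp only [eval_mul, eval_add, eval_pow, eval_X, eval_C] at h
  rw [h, recA_laguerreWeight, recB_laguerreWeight, mul_add 2 j 1, mul_one]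
  cases j with
  | zero => simp [hermiteB_zero]
  | succ j =>
    rw [if_neg (by omega), recB_laguerreWeight]
    rfl

theorem eval_assocPoly (w : ℝ → ℝ) (m l : ℕ) (x : ℝ) :
    (assocPoly w m l).eval x =
      jacobiSol (fun i => recA w (m + i)) (fun i => recB w (m + i)) x l := by
  induction l using Nat.twoStepInduction with
  | zero => simp [assocPoly, jacobiSol]
  | one => simp [assocPoly, jacobiSol]
  | more l ih₀ ih₁ =>
    rw [assocPoly, jacobiSol, ← ih₀, ← ih₁]
    simp only [eval_mul, eval_sub, eval_C, eval_X]
    rfl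

/-- The associated polynomials of order zero are the orthonormal polynomials, up to a constant. -/
theorem IsRegularWeight.exists_orthonormalPoly_eq {w : ℝ → ℝ} (hw : IsRegularWeight w) :
    ∃ c : ℝ, c ≠ 0 ∧ ∀ l, orthonormalPoly w l = C c * assocPoly w 0 l := by
  have h0 : orthonormalPoly w 0 = C ((orthonormalPoly w 0).coeff 0) :=
    eq_C_of_natDegree_eq_zero (hw.natDegree_orthonormalPoly 0)
  have hinv : ∀ l, C (recB w l) * C (recB w l)⁻¹ = 1 := fun l => by
    rw [← C_mul, mul_inv_cancel₀ (hw.recB_pos l).ne', C_1]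
  refine ⟨(orthonormalPoly w 0).coeff 0, fun h => hw.orthonormalPoly_ne_zero 0 ?_, fun l => ?_⟩
  · rw [h0, h, C_0]
  set c := (orthonormalPoly w 0).coeff 0
  induction l using Nat.twoStepInduction with
  | zero => rw [assocPoly, mul_one, h0]
  | one =>
    apply mul_left_cancel₀ (C_ne_zero.2 (hw.recB_pos 1).ne')
    have h := hw.X_mul_orthonormalPoly_zero
    rw [h0] at h
    rw [assocPoly, zero_add]
    linear_combination -h - C c * (X - C (recA w 0)) * hinv 1
  | more l ih₀ ih₁ =>
    apply mul_left_cancel₀ (C_ne_zero.2 (hw.recB_pos (l + 2)).ne')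
    have h := hw.X_mul_orthonormalPoly_succ l
    rw [ih₀, ih₁] at h
    rw [assocPoly]
    simp only [zero_add]
    linear_combination -h - C c * ((X - C (recA w (l + 1))) * assocPoly w 0 (l + 1)
        - C (recB w (l + 1)) * assocPoly w 0 l) * hinv (l + 2)

section Blocks

open Finset

/-- A Christoffel–Darboux formula. -/
theorem sub_mul_sum_jacobiSol_mul {a b h : ℕ → ℝ} {x bot : ℝ} (hb : ∀ l, 0 < b (l + 1))
    (h0 : x * h 0 = b 1 * h 1 + a 0 * h 0 + bot)
    (hs : ∀ i, x * h (i + 1) = b (i + 2) * h (i + 2) + a (i + 1) * h (i + 1) + b (i + 1) * h i)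
    (y : ℝ) (M : ℕ) :
    (x - y) * ∑ i ∈ range (M + 1), jacobiSol a b y i * h i =
      b (M + 1) * (jacobiSol a b y M * h (M + 1) - jacobiSol a b y (M + 1) * h M) + bot := by
  -- The sum telescopes. The term `bot`, the coupling to the polynomial just below the block, enters
  -- through `h 0` only and is carried along unchanged.
  induction M with
  | zero =>
    have h1 : b 1 * jacobiSol a b y 1 = y - a 0 := by
      rw [jacobiSol, mul_inv_cancel_left₀ (hb 0).ne']
    rw [zero_add, sum_range_one, jacobiSol.eq_1]
    linear_combination h0 + h 0 * h1
  | succ M ih =>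
    have h1 : b (M + 2) * jacobiSol a b y (M + 2) =
        (y - a (M + 1)) * jacobiSol a b y (M + 1) - b (M + 1) * jacobiSol a b y M := by
      rw [jacobiSol, mul_inv_cancel_left₀ (hb (M + 1)).ne']
    rw [sum_range_succ, mul_add, ih]
    linear_combination jacobiSol a b y (M + 1) * hs M + h (M + 1) * h1

/-- The diagonal coefficients of `x²` on the Hermite polynomials `h_{2s}, h_{2s+2}, …`. -/
noncomputable def evenA (s i : ℕ) : ℝ := recA (laguerreWeight (-1 / 2)) (s + i)

/-- The off-diagonal coefficients of `x²` on the Hermite polynomials `h_{2s}, h_{2s+2}, …`. -/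
noncomputable def evenB (s i : ℕ) : ℝ := recB (laguerreWeight (-1 / 2)) (s + i)

/-- The diagonal coefficients of `x²` on the Hermite polynomials `h_{2s+1}, h_{2s+3}, …`. -/
noncomputable def oddA (s i : ℕ) : ℝ := ((2 * (s + i) + 1 : ℕ) : ℝ) + 1 / 2

/-- The off-diagonal coefficients of `x²` on the Hermite polynomials `h_{2s+1}, h_{2s+3}, …`. -/
noncomputable def oddB (s i : ℕ) : ℝ := hermiteB (2 * (s + i)) * hermiteB (2 * (s + i) + 1)

theorem evenB_succ_pos (s l : ℕ) : 0 < evenB s (l + 1) := isRegularWeight_laguerreWeight.recB_pos _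

theorem eval_laguerreAssoc (s l : ℕ) (x : ℝ) :
    (laguerreAssoc (-1 / 2) s l).eval x = jacobiSol (evenA s) (evenB s) x l :=
  eval_assocPoly _ _ _ _

/-- The Christoffel–Darboux formula for the Hermite polynomials of even degree. -/
theorem sub_mul_sum_jacobiSol_mul_hermiteON (s M : ℕ) (y x : ℝ) :
    (x ^ 2 - y) * ∑ i ∈ range (M + 1),
        jacobiSol (evenA s) (evenB s) y i * (hermiteON (2 * (s + i))).eval x =
      evenB s (M + 1) *
        (jacobiSol (evenA s) (evenB s) y M * (hermiteON (2 * (s + (M + 1)))).eval x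
          - jacobiSol (evenA s) (evenB s) y (M + 1) * (hermiteON (2 * (s + M))).eval x)
      + evenB s 0 * (if 2 * s = 0 then 0 else (hermiteON (2 * s - 2)).eval x) :=
  sub_mul_sum_jacobiSol_mul (h := fun i => (hermiteON (2 * (s + i))).eval x)
    (fun _ => evenB_succ_pos _ _) (X_sq_mul_hermiteON_two_mul s x)
    (fun i => by
      have h := X_sq_mul_hermiteON_two_mul (s + (i + 1)) x
      rwa [if_neg (by omega), show 2 * (s + (i + 1)) - 2 = 2 * (s + i) by omega] at h) y M

/-- The off-diagonal entries of the Jacobi matrices of `x²` on the Hermite polynomials of even and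
of odd degree are close enough for the discrete Hardy inequality. -/
theorem sq_sub_hermiteB_mul_le (j : ℕ) :
    (hermiteB (2 * j + 2) * hermiteB (2 * j + 3) - hermiteB (2 * j + 1) * hermiteB (2 * j + 2)) ^ 2
      ≤ (1 / 2 * (1 + 1 / (2 * (j + 1)))) * (1 - 1 / 2 * (1 + 1 / (2 * (j + 1 + 1)))) := by
  have h1 := hermiteB_sq (2 * j + 1)
  have h2 := hermiteB_sq (2 * j + 2)
  have h3 := hermiteB_sq (2 * j + 3)
  have p1 := hermiteB_pos (l := 2 * j + 1) (by omega)
  have p3 := hermiteB_pos (l := 2 * j + 3) (by omega)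
  push_cast at h1 h2 h3
  set p := hermiteB (2 * j + 1)
  set q := hermiteB (2 * j + 2)
  set r := hermiteB (2 * j + 3)
  set L : ℝ := j + 1 with hL
  have hL1 : 1 ≤ L := by
    have : (0 : ℝ) ≤ j := Nat.cast_nonneg j
    linarith
  have hp : p ^ 2 = L - 1 / 2 := by rw [h1, hL]; ring
  have hq : q ^ 2 = L := by rw [h2, hL]; ring
  have hr : r ^ 2 = L + 1 / 2 := by rw [h3, hL]; ring
  have hpr : (p * r) ^ 2 = L ^ 2 - 1 / 4 := by rw [mul_pow, hp, hr]; ring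
  -- With `p² = L - 1/2`, `q² = L`, `r² = L + 1/2` the left side is `2 L (L - p r)`, and `R` is
  -- chosen so that the right side is `2 L R`. It remains to see `L - R ≤ √(L² - 1/4)`, which after
  -- squaring is the bound `hR2`.
  set R : ℝ := (1 + 1 / (4 * L * (L + 1))) / (8 * L) with hR
  have hRL : 2 * L * R = 1 / 4 + 1 / (16 * L * (L + 1)) := by
    rw [hR]; field_simp; ring
  have hR2 : R ^ 2 ≤ 1 / (16 * L * (L + 1)) := by
    rw [hR, div_pow, div_le_div_iff₀ (by positivity) (by positivity)]
    have h8 : 1 / (4 * L * (L + 1)) ≤ 1 / 8 := by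
      rw [div_le_div_iff₀ (by positivity) (by norm_num)]
      nlinarith
    have h9 : 0 ≤ 1 / (4 * L * (L + 1)) := by positivity
    have h10 : (1 + 1 / (4 * L * (L + 1))) ^ 2 ≤ 2 := by nlinarith
    have h11 : 16 * L * (L + 1) ≤ 32 * L ^ 2 := by nlinarith
    calc _ ≤ 2 * (16 * L * (L + 1)) := by gcongr
      _ ≤ _ := by linarith
  have hle : L - R ≤ p * r := by
    apply le_of_sq_le_sq _ (by positivity)
    rw [hpr]
    nlinarith
  have hexp : (q * r - p * q) ^ 2 = 2 * L * (L - p * r) := by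
    have : (q * r - p * q) ^ 2 = q ^ 2 * (r ^ 2 + p ^ 2 - 2 * (p * r)) := by ring
    rw [this, hq, hr, hp]
    ring
  have hrhs : (1 / 2 * (1 + 1 / (2 * L))) * (1 - 1 / 2 * (1 + 1 / (2 * (L + 1)))) = 2 * L * R := by
    rw [hRL]; field_simp; ring
  rw [hexp, hrhs]
  have : L - p * r ≤ R := by linarith
  gcongr

/-- The form of `x²` on the Hermite polynomials of even degree is dominated by the one on those of
odd degree. -/
theorem jacobiForm_even_le_odd (s M : ℕ) (d : ℕ → ℝ) :
    jacobiForm (evenA s) (evenB s) M d ≤ jacobiForm (oddA s) (oddB s) M d := by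
  -- No constant weight works: `u (1 - u)` is at most `1/4`, while the squared differences of
  -- off-diagonal entries slightly exceed `1/4`. The decaying correction to `1/2` supplies the
  -- margin.
  refine jacobiForm_le_jacobiForm (u := fun i => 1 / 2 * (1 + 1 / (2 * ((s + i : ℕ) + 1))))
    (fun l => ?_) (fun l => by positivity) ?_ (fun l => ?_) M d
  · rw [evenA, oddA, recA_laguerreWeight]
    push_cast
    linarith
  · have h0 : (0 : ℝ) ≤ (s + 0 : ℕ) := Nat.cast_nonneg _
    have h : 1 / (2 * (((s + 0 : ℕ) : ℝ) + 1)) ≤ 1 := by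
      rw [div_le_one (by positivity)]
      linarith
    linarith
  · have h := sq_sub_hermiteB_mul_le (s + l)
    rw [evenB, oddB, ← add_assoc, recB_laguerreWeight, mul_add 2 (s + l) 1]
    push_cast at h ⊢
    exact h

/-- The value of a bilinear expression on a combination of polynomials with tridiagonal Gram
matrix. -/
theorem map_sum_mul_sum_eq_jacobiForm (L : ℝ[X] →ₗ[ℝ] ℝ) (g : ℝ[X]) (v : ℕ → ℝ[X]) {a b : ℕ → ℝ}
    (ha : ∀ i, L (g * (v i * v i)) = a i) (hb : ∀ i, L (g * (v i * v (i + 1))) = b (i + 1))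
    (h0 : ∀ i j, i + 1 < j → L (g * (v i * v j)) = 0) (N : ℕ) (d : ℕ → ℝ) :
    L (g * ((∑ i ∈ range N, C (d i) * v i) * ∑ i ∈ range N, C (d i) * v i)) =
      jacobiForm a b N d := by
  have hC : ∀ (c : ℝ) (p : ℝ[X]), L (C c * p) = c * L p := fun c p => by
    rw [← smul_eq_C_mul, map_smul, smul_eq_mul]
  induction N with
  | zero => simp [jacobiForm]
  | succ N ih =>
    have hcross : L (g * ((∑ i ∈ range N, C (d i) * v i) * v N)) =
        if N = 0 then 0 else b N * d (N - 1) := by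
      rw [sum_mul, mul_sum, map_sum]
      cases N with
      | zero => simp
      | succ N =>
        rw [sum_range_succ, if_neg N.succ_ne_zero, sum_eq_zero, zero_add, Nat.add_sub_cancel,
          mul_assoc, mul_left_comm, hC, hb, mul_comm]
        intro i hi
        rw [mul_assoc, mul_left_comm, hC, h0 i (N + 1) (by have := mem_range.1 hi; omega), mul_zero]
    set S := ∑ i ∈ range N, C (d i) * v i with hS
    have hsplit : g * ((S + C (d N) * v N) * (S + C (d N) * v N)) =
        g * (S * S) + C (2 * d N) * (g * (S * v N)) + C (d N ^ 2) * (g * (v N * v N)) := by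
      simp only [C_mul, C_pow, C_ofNat]
      ring
    rw [sum_range_succ, ← hS, hsplit, map_add, map_add, hC, hC, ih, hcross, ha]
    cases N with
    | zero => simp [jacobiForm, mul_comm]
    | succ N =>
      rw [if_neg N.succ_ne_zero]
      simp only [jacobiForm, Nat.add_sub_cancel]
      rw [sum_range_succ _ (N + 1), sum_range_succ _ N, sum_range_succ _ N]
      ring

end Blocks

end OptHermite

/-! ### The variance as a sum of Jacobi forms, and its minimizers. -/

namespace OptHermite

open Finset MeasureTheory

/-- The combination of the Hermite polynomials `h_{2s}, …, h_{2(s+M)}` with even coefficients `e`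
and odd coefficients `o`. -/
noncomputable def blockPoly (s M : ℕ) (e o : ℕ → ℝ) : ℝ[X] :=
  ∑ i ∈ range (M + 1), C (e i) * hermiteON (2 * (s + i)) +
    ∑ i ∈ range M, C (o i) * hermiteON (2 * (s + i) + 1)

/-- Stated for a general factor `g` so that `g = 1` yields the norm and `g = X ^ 2` the variance; in
both cases parity decouples even from odd degrees. -/
theorem integral_mul_blockPoly_sq (s M : ℕ) (e o : ℕ → ℝ) (g : ℝ[X]) {a b a' b' : ℕ → ℝ}
    (hcross : ∀ i j, isRegularWeight_hermiteWeight.integral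
      (g * (hermiteON (2 * i) * hermiteON (2 * j + 1))) = 0)
    (hfar : ∀ i j, i + 2 < j → isRegularWeight_hermiteWeight.integral
      (g * (hermiteON i * hermiteON j)) = 0)
    (ha : ∀ i, isRegularWeight_hermiteWeight.integral
      (g * (hermiteON (2 * (s + i)) * hermiteON (2 * (s + i)))) = a i)
    (hb : ∀ i, isRegularWeight_hermiteWeight.integral
      (g * (hermiteON (2 * (s + i)) * hermiteON (2 * (s + (i + 1))))) = b (i + 1))
    (ha' : ∀ i, isRegularWeight_hermiteWeight.integral
      (g * (hermiteON (2 * (s + i) + 1) * hermiteON (2 * (s + i) + 1))) = a' i)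
    (hb' : ∀ i, isRegularWeight_hermiteWeight.integral
      (g * (hermiteON (2 * (s + i) + 1) * hermiteON (2 * (s + (i + 1)) + 1))) = b' (i + 1)) :
    isRegularWeight_hermiteWeight.integral (g * (blockPoly s M e o * blockPoly s M e o)) =
      jacobiForm a b (M + 1) e + jacobiForm a' b' M o := by
  have h1 := map_sum_mul_sum_eq_jacobiForm isRegularWeight_hermiteWeight.integral g
    (fun i => hermiteON (2 * (s + i))) ha hb (fun i j hij => hfar _ _ (by omega)) (M + 1) e
  have h2 := map_sum_mul_sum_eq_jacobiForm isRegularWeight_hermiteWeight.integral g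
    (fun i => hermiteON (2 * (s + i) + 1)) ha' hb' (fun i j hij => hfar _ _ (by omega)) M o
  rw [blockPoly]
  set E := ∑ i ∈ range (M + 1), C (e i) * hermiteON (2 * (s + i)) with hE
  set O := ∑ i ∈ range M, C (o i) * hermiteON (2 * (s + i) + 1) with hO
  have h3 : isRegularWeight_hermiteWeight.integral (g * (E * O)) = 0 := by
    rw [hE, hO, sum_mul_sum, mul_sum, map_sum]
    refine sum_eq_zero fun i _ => ?_
    rw [mul_sum, map_sum]
    refine sum_eq_zero fun j _ => ?_
    have : g * (C (e i) * hermiteON (2 * (s + i)) * (C (o j) * hermiteON (2 * (s + j) + 1))) =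
        C (e i) * (C (o j) * (g * (hermiteON (2 * (s + i)) * hermiteON (2 * (s + j) + 1)))) := by
      ring
    rw [this, IsRegularWeight.integral_C_mul, IsRegularWeight.integral_C_mul, hcross, mul_zero,
      mul_zero]
  have h4 : g * ((E + O) * (E + O)) = g * (E * E) + g * (O * O) + C 2 * (g * (E * O)) := by
    simp only [C_ofNat]
    ring
  rw [h4, map_add, map_add, IsRegularWeight.integral_C_mul, h1, h2, h3, mul_zero, add_zero]

theorem integral_blockPoly_sq (s M : ℕ) (e o : ℕ → ℝ) :
    isRegularWeight_hermiteWeight.integral (blockPoly s M e o * blockPoly s M e o) =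
      ∑ i ∈ range (M + 1), e i ^ 2 + ∑ i ∈ range M, o i ^ 2 := by
  have h := integral_mul_blockPoly_sq s M e o 1 (a := fun _ => 1) (b := fun _ => 0)
    (a' := fun _ => 1) (b' := fun _ => 0)
    (fun i j => by rw [one_mul, integral_hermiteON_mul, if_neg (by omega)])
    (fun i j h => by rw [one_mul, integral_hermiteON_mul, if_neg (by omega)])
    (fun i => by rw [one_mul, integral_hermiteON_mul, if_pos rfl])
    (fun i => by rw [one_mul, integral_hermiteON_mul, if_neg (by omega)])
    (fun i => by rw [one_mul, integral_hermiteON_mul, if_pos rfl])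
    (fun i => by rw [one_mul, integral_hermiteON_mul, if_neg (by omega)])
  simpa [jacobiForm] using h

theorem integral_X_sq_mul_blockPoly_sq (s M : ℕ) (e o : ℕ → ℝ) :
    isRegularWeight_hermiteWeight.integral (X ^ 2 * (blockPoly s M e o * blockPoly s M e o)) =
      jacobiForm (evenA s) (evenB s) (M + 1) e + jacobiForm (oddA s) (oddB s) M o :=
  integral_mul_blockPoly_sq s M e o (X ^ 2)
    (fun i j => integral_X_sq_mul_hermiteON_eq_zero (by omega) (by omega) (by omega))
    (fun i j h => integral_X_sq_mul_hermiteON_eq_zero (by omega) (by omega) (by omega))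
    (fun i => by rw [integral_X_sq_mul_hermiteON_self, evenA, recA_laguerreWeight])
    (fun i => by
      rw [← add_assoc, mul_add 2 (s + i) 1, mul_one, integral_X_sq_mul_hermiteON_add_two, evenB,
        ← add_assoc, recB_laguerreWeight])
    (fun i => by rw [integral_X_sq_mul_hermiteON_self, oddA])
    (fun i => integral_X_sq_mul_hermiteON_add_two (2 * (s + i) + 1))

/-- A real polynomial, as a complex polynomial. -/
noncomputable def toComplex (p : ℝ[X]) : ℂ[X] := p.map Complex.ofRealHom

theorem eval_toComplex (p : ℝ[X]) (x : ℝ) : (toComplex p).eval (x : ℂ) = (p.eval x : ℝ) := by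
  rw [toComplex, eval_map]
  exact eval₂_at_apply Complex.ofRealHom x

theorem toComplex_sum {ι : Type*} (t : Finset ι) (f : ι → ℝ[X]) :
    toComplex (∑ i ∈ t, f i) = ∑ i ∈ t, toComplex (f i) :=
  Polynomial.map_sum _ _ _

theorem toComplex_C_mul (c : ℝ) (p : ℝ[X]) :
    toComplex (C c * p) = C (c : ℂ) * toComplex p := by
  simp [toComplex]

theorem toComplex_add (p q : ℝ[X]) : toComplex (p + q) = toComplex p + toComplex q :=
  Polynomial.map_add _

/-- On the real line `|f + i g|² = f² + g²`, so a complex polynomial contributes two independent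
real ones to the norm and to the variance. -/
theorem norm_sq_eval_add_I_mul (f g : ℝ[X]) (x : ℝ) :
    ‖(toComplex f + C Complex.I * toComplex g).eval (x : ℂ)‖ ^ 2 =
      (f * f).eval x + (g * g).eval x := by
  rw [eval_add, eval_mul, eval_C, eval_toComplex, eval_toComplex, Complex.sq_norm, mul_comm,
    Complex.normSq_add_mul_I, eval_mul, eval_mul]
  ring

theorem normSqH_add_I_mul (f g : ℝ[X]) :
    normSqH (onReal (toComplex f + C Complex.I * toComplex g)) =
      isRegularWeight_hermiteWeight.integral (f * f) +
        isRegularWeight_hermiteWeight.integral (g * g) := by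
  rw [← map_add, IsRegularWeight.integral_apply, normSqH]
  simp only [onReal, norm_sq_eval_add_I_mul]
  simp only [eval_add, hermiteWeight]

theorem varS_add_I_mul (f g : ℝ[X]) :
    varS (onReal (toComplex f + C Complex.I * toComplex g)) =
      isRegularWeight_hermiteWeight.integral (X ^ 2 * (f * f)) +
        isRegularWeight_hermiteWeight.integral (X ^ 2 * (g * g)) := by
  rw [← map_add, ← mul_add, IsRegularWeight.integral_apply, varS]
  simp only [onReal, norm_sq_eval_add_I_mul]
  simp only [eval_add, eval_mul, eval_pow, eval_X, hermiteWeight]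

theorem normSqH_C_mul (c : ℂ) (p : ℝ[X]) :
    normSqH (onReal (C c * toComplex p)) =
      ‖c‖ ^ 2 * isRegularWeight_hermiteWeight.integral (p * p) := by
  rw [IsRegularWeight.integral_apply, normSqH, ← integral_const_mul]
  refine integral_congr_ae (.of_forall fun x => ?_)
  simp only [onReal, eval_mul, eval_C, eval_toComplex, norm_mul, Complex.norm_real, mul_pow,
    Real.norm_eq_abs, sq_abs, hermiteWeight]
  ring

theorem varS_C_mul (c : ℂ) (p : ℝ[X]) :
    varS (onReal (C c * toComplex p)) =
      ‖c‖ ^ 2 * isRegularWeight_hermiteWeight.integral (X ^ 2 * (p * p)) := by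
  rw [IsRegularWeight.integral_apply, varS, ← integral_const_mul]
  refine integral_congr_ae (.of_forall fun x => ?_)
  simp only [onReal, eval_mul, eval_C, eval_toComplex, norm_mul, Complex.norm_real, mul_pow,
    Real.norm_eq_abs, sq_abs, hermiteWeight, eval_pow, eval_X]
  ring

theorem sum_Icc_two_mul {A : Type*} [AddCommMonoid A] (f : ℕ → A) (s M : ℕ) :
    ∑ l ∈ Icc (2 * s) (2 * (s + M)), f l =
      ∑ i ∈ range (M + 1), f (2 * (s + i)) + ∑ i ∈ range M, f (2 * (s + i) + 1) := by
  induction M with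
  | zero => simp
  | succ M ih =>
    rw [show 2 * (s + (M + 1)) = 2 * (s + M) + 1 + 1 by ring, sum_Icc_succ_top (by omega),
      sum_Icc_succ_top (by omega), ih, sum_range_succ _ (M + 1),
      sum_range_succ (fun i => f (2 * (s + i) + 1)) M, show 2 * (s + (M + 1)) = 2 * (s + M) + 1 + 1 by ring]
    abel

theorem exists_blockPoly_of_mem_spaceMN {s M : ℕ} {P : ℂ[X]}
    (hP : P ∈ spaceMN (2 * s) (2 * (s + M))) :
    ∃ e o e' o' : ℕ → ℝ,
      P = toComplex (blockPoly s M e o) + C Complex.I * toComplex (blockPoly s M e' o') := by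
  rw [spaceMN, ← Finset.coe_Icc, Submodule.mem_span_image_finset_iff_exists_fun'] at hP
  obtain ⟨c, rfl⟩ := hP
  have hterm : ∀ l, c l • (hermiteON l).map Complex.ofRealHom =
      toComplex (C (c l).re * hermiteON l) +
        C Complex.I * toComplex (C (c l).im * hermiteON l) := by
    intro l
    rw [smul_eq_C_mul, toComplex_C_mul, toComplex_C_mul, ← mul_assoc, ← C_mul, ← add_mul, ← C_add,
      mul_comm Complex.I, Complex.re_add_im, toComplex]
  refine ⟨fun i => (c (2 * (s + i))).re, fun i => (c (2 * (s + i) + 1)).re,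
    fun i => (c (2 * (s + i))).im, fun i => (c (2 * (s + i) + 1)).im, ?_⟩
  simp only [hterm]
  rw [sum_Icc_two_mul]
  simp only [blockPoly, toComplex_add, toComplex_sum, mul_add, mul_sum, sum_add_distrib]
  abel

theorem toComplex_hermiteON_mem {m n l : ℕ} (h1 : m ≤ l) (h2 : l ≤ n) :
    toComplex (hermiteON l) ∈ spaceMN m n :=
  Submodule.subset_span ⟨l, ⟨h1, h2⟩, rfl⟩

/-- The combination of Hermite polynomials of even degree whose coefficients are the values at `x`
of the associated Laguerre polynomials. -/
noncomputable def extremalPoly (s M : ℕ) (x : ℝ) : ℝ[X] :=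
  ∑ i ∈ range (M + 1), C (jacobiSol (evenA s) (evenB s) x i) * hermiteON (2 * (s + i))

theorem blockPoly_zero_right (s M : ℕ) (x : ℝ) :
    blockPoly s M (jacobiSol (evenA s) (evenB s) x) (fun _ => 0) = extremalPoly s M x := by
  simp [blockPoly, extremalPoly]

theorem C_mul_extremalPoly_mem (s M : ℕ) (x : ℝ) (c : ℂ) :
    C c * toComplex (extremalPoly s M x) ∈ spaceMN (2 * s) (2 * (s + M)) := by
  rw [← smul_eq_C_mul]
  refine Submodule.smul_mem _ _ ?_
  rw [extremalPoly, toComplex_sum]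
  refine Submodule.sum_mem _ fun i hi => ?_
  have := mem_range.1 hi
  rw [toComplex_C_mul, ← smul_eq_C_mul]
  exact Submodule.smul_mem _ _ (toComplex_hermiteON_mem (by omega) (by omega))

/-- The form of `x²` on the Hermite polynomials of odd degree exceeds the least eigenvalue of the
form on those of even degree. -/
theorem le_jacobiForm_odd_and_eq_zero {s M : ℕ} {x : ℝ}
    (hx : jacobiSol (evenA s) (evenB s) x (M + 1) = 0)
    (hmin : ∀ d, x * ∑ l ∈ range (M + 1), d l ^ 2 ≤ jacobiForm (evenA s) (evenB s) (M + 1) d)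
    (heq : ∀ d, jacobiForm (evenA s) (evenB s) (M + 1) d = x * ∑ l ∈ range (M + 1), d l ^ 2 →
        ∀ l ≤ M, d l = d 0 * jacobiSol (evenA s) (evenB s) x l) (o : ℕ → ℝ) :
    x * ∑ l ∈ range M, o l ^ 2 ≤ jacobiForm (oddA s) (oddB s) M o ∧
      (jacobiForm (oddA s) (oddB s) M o = x * ∑ l ∈ range M, o l ^ 2 → ∀ l < M, o l = 0) := by
  -- The odd block has size `M`, the even one `M + 1`. Padding by a zero makes the odd coefficients
  -- a test vector for the even minimum.
  let d : ℕ → ℝ := fun l => if l < M then o l else 0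
  have hd : ∀ l < M, d l = o l := fun l hl => if_pos hl
  have hdM : d M = 0 := if_neg (lt_irrefl M)
  have hsum : ∑ l ∈ range (M + 1), d l ^ 2 = ∑ l ∈ range M, o l ^ 2 := by
    rw [sum_range_succ, hdM, sum_congr rfl fun l hl => by rw [hd l (mem_range.1 hl)]]
    simp
  have hform : jacobiForm (evenA s) (evenB s) (M + 1) d = jacobiForm (evenA s) (evenB s) M o := by
    rw [← jacobiForm_congr _ _ hd]
    cases M with
    | zero => simp [jacobiForm, hdM]
    | succ M =>
      simp only [jacobiForm, Nat.add_sub_cancel]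
      rw [sum_range_succ _ (M + 1), sum_range_succ _ M, sum_range_succ _ M, hdM]
      ring
  have h1 := hmin d
  have h2 := jacobiForm_even_le_odd s M o
  rw [hsum, hform] at h1
  refine ⟨h1.trans h2, fun h l hl => ?_⟩
  have h3 := heq d (by rw [hform, hsum]; linarith)
  -- In the case of equality `d` is a multiple of the eigenvector; its last entry is zero while that
  -- of the eigenvector is not, so the multiple is zero.
  have h4 := h3 M le_rfl
  rw [hdM, eq_comm, mul_eq_zero] at h4
  rw [← hd l hl, h3 l hl.le, h4.resolve_right (jacobiSol_ne_zero (evenB_succ_pos s) hx), zero_mul]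

/-- The optimal polynomials are the normalized multiples of the extremal polynomial. -/
theorem exists_isLeast_isOptimal (s M : ℕ) :
    ∃ x : ℝ, IsLeast {y | jacobiSol (evenA s) (evenB s) y (M + 1) = 0} x ∧
      (∃ P, IsOptimal (spaceMN (2 * s) (2 * (s + M))) P) ∧
      ∀ P, IsOptimal (spaceMN (2 * s) (2 * (s + M))) P ↔
        P ∈ unitSphere (spaceMN (2 * s) (2 * (s + M))) ∧
          ∃ c : ℂ, P = C c * toComplex (extremalPoly s M x) := by
  obtain ⟨x, hleast, hmin, heq⟩ := exists_isLeast_jacobiSol (evenA s) (evenB_succ_pos s) M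
  have hodd := le_jacobiForm_odd_and_eq_zero hleast.1 hmin heq
  have hnorm := integral_blockPoly_sq s M (jacobiSol (evenA s) (evenB s) x) (fun _ => 0)
  have hvar := integral_X_sq_mul_blockPoly_sq s M (jacobiSol (evenA s) (evenB s) x) (fun _ => 0)
  rw [blockPoly_zero_right] at hnorm hvar
  rw [jacobiForm_jacobiSol (evenB_succ_pos s) hleast.1] at hvar
  have hpos := sum_sq_jacobiSol_pos (evenA s) (evenB s) x M
  set N := ∑ l ∈ range (M + 1), jacobiSol (evenA s) (evenB s) x l ^ 2 with hN
  have hnorm' : isRegularWeight_hermiteWeight.integral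
      (extremalPoly s M x * extremalPoly s M x) = N := by simpa using hnorm
  have hvar' : isRegularWeight_hermiteWeight.integral
      (X ^ 2 * (extremalPoly s M x * extremalPoly s M x)) = x * N := by
    simpa [jacobiForm] using hvar
  have hvarC : ∀ c : ℂ, C c * toComplex (extremalPoly s M x) ∈
      unitSphere (spaceMN (2 * s) (2 * (s + M))) →
      varS (onReal (C c * toComplex (extremalPoly s M x))) = x := by
    intro c hc
    have h1 := hc.2
    rw [normSqH_C_mul, hnorm'] at h1
    rw [varS_C_mul, hvar']
    linear_combination x * h1
  have hlower : ∀ Q ∈ unitSphere (spaceMN (2 * s) (2 * (s + M))), x ≤ varS (onReal Q) ∧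
      (varS (onReal Q) ≤ x → ∃ c : ℂ, Q = C c * toComplex (extremalPoly s M x)) := by
    rintro Q ⟨hQ, hQ1⟩
    obtain ⟨e, o, e', o', rfl⟩ := exists_blockPoly_of_mem_spaceMN hQ
    rw [normSqH_add_I_mul, integral_blockPoly_sq, integral_blockPoly_sq] at hQ1
    rw [varS_add_I_mul, integral_X_sq_mul_blockPoly_sq, integral_X_sq_mul_blockPoly_sq]
    have h1 := hmin e
    have h2 := hmin e'
    have h3 := (hodd o).1
    have h4 := (hodd o').1
    -- The normalization distributes `x` over the four real blocks, each bounded below by its share;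
    -- a total of at most `x` therefore forces equality in every block.
    have h5 : x = x * (∑ i ∈ range (M + 1), e i ^ 2) + x * (∑ i ∈ range M, o i ^ 2) +
        (x * (∑ i ∈ range (M + 1), e' i ^ 2) + x * (∑ i ∈ range M, o' i ^ 2)) := by
      linear_combination (-x) * hQ1
    refine ⟨by linarith, fun hle => ⟨(e 0 : ℂ) + Complex.I * (e' 0 : ℂ), ?_⟩⟩
    have he := heq e (by linarith)
    have he' := heq e' (by linarith)
    have ho := (hodd o).2 (by linarith)
    have ho' := (hodd o').2 (by linarith)
    have key : ∀ e o : ℕ → ℝ, (∀ l ≤ M, e l = e 0 * jacobiSol (evenA s) (evenB s) x l) →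
        (∀ l < M, o l = 0) → blockPoly s M e o = C (e 0) * extremalPoly s M x := by
      intro e o he ho
      rw [blockPoly, extremalPoly, mul_sum, sum_eq_zero (s := range M), add_zero]
      · refine sum_congr rfl fun i hi => ?_
        rw [he i (by have := mem_range.1 hi; omega), C_mul, mul_assoc]
      · intro i hi
        rw [ho i (mem_range.1 hi), C_0, zero_mul]
    rw [key e o he ho, key e' o' he' ho', toComplex_C_mul, toComplex_C_mul, C_add, C_mul]
    ring
  have hex : ∃ c : ℂ, C c * toComplex (extremalPoly s M x) ∈
      unitSphere (spaceMN (2 * s) (2 * (s + M))) := by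
    refine ⟨((√N)⁻¹ : ℝ), C_mul_extremalPoly_mem s M x _, ?_⟩
    rw [normSqH_C_mul, hnorm', Complex.norm_real, Real.norm_eq_abs, sq_abs, inv_pow,
      Real.sq_sqrt hpos.le, inv_mul_cancel₀ hpos.ne']
  obtain ⟨c₀, hc₀⟩ := hex
  refine ⟨x, hleast, ⟨_, hc₀, fun Q hQ => ?_⟩, fun P => ⟨fun hP => ⟨hP.1, ?_⟩, ?_⟩⟩
  · rw [hvarC c₀ hc₀]
    exact (hlower Q hQ).1
  · refine (hlower P hP.1).2 ?_
    rw [← hvarC c₀ hc₀]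
    exact hP.2 _ hc₀
  · rintro ⟨hP, c, rfl⟩
    refine ⟨hP, fun Q hQ => ?_⟩
    rw [hvarC c hP]
    exact (hlower Q hQ).1

/-- Infinitely many values determine a polynomial, so nothing is lost by excluding the points with
`x² = y`; the ray beyond `|y| + 1` avoids them. -/
theorem eq_C_mul_toComplex_iff (P : ℂ[X]) (p : ℝ[X]) (y : ℝ) (c : ℂ) :
    P = C c * toComplex p ↔ ∀ x : ℝ, x ^ 2 ≠ y → P.eval (x : ℂ) = c * (p.eval x : ℝ) := by
  constructor
  · rintro rfl x _
    rw [eval_mul, eval_C, eval_toComplex]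
  · intro h
    refine Polynomial.eq_of_infinite_eval_eq _ _ ?_
    have hinf : ((fun x : ℝ => (x : ℂ)) '' {x : ℝ | |y| + 1 < x}).Infinite :=
      (Set.Ioi_infinite (|y| + 1)).image Complex.ofReal_injective.injOn
    refine hinf.mono ?_
    rintro _ ⟨x, hx, rfl⟩
    have hx : |y| + 1 < x := hx
    have hne : x ^ 2 ≠ y := by
      have := le_abs_self y
      have := abs_nonneg y
      nlinarith
    simp only [Set.mem_ofPred_eq]
    rw [h x hne, eval_mul, eval_C, eval_toComplex]

/-- In the Christoffel–Darboux formula the term with `jacobiSol` at `M + 1` drops out because `y` is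
a zero of it. -/
theorem eval_extremalPoly {s M : ℕ} {y : ℝ}
    (hy : jacobiSol (evenA s) (evenB s) y (M + 1) = 0) {x : ℝ} (hx : x ^ 2 ≠ y) :
    (extremalPoly s M y).eval x =
      (evenB s (M + 1) * jacobiSol (evenA s) (evenB s) y M *
          (hermiteON (2 * (s + (M + 1)))).eval x
        + evenB s 0 * (if 2 * s = 0 then 0 else (hermiteON (2 * s - 2)).eval x)) / (x ^ 2 - y) := by
  have h := sub_mul_sum_jacobiSol_mul_hermiteON s M y x
  rw [hy] at h
  rw [eq_div_iff (sub_ne_zero.2 hx), extremalPoly, eval_finsetSum]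
  simp only [eval_mul, eval_C]
  linear_combination h

/-- The optimal polynomials in the span of `h_{2s}, …, h_{2(s+M)}`. -/
theorem exists_isLeast_isOptimal_iff_eval (s M : ℕ) :
    ∃ lam : ℝ,
      IsLeast {x : ℝ | (laguerreAssoc (-1 / 2) s (M + 1)).eval x = 0} lam ∧
      (∃ P : ℂ[X], IsOptimal (spaceMN (2 * s) (2 * (s + M))) P) ∧
      (∀ P : ℂ[X], IsOptimal (spaceMN (2 * s) (2 * (s + M))) P ↔
        P ∈ unitSphere (spaceMN (2 * s) (2 * (s + M))) ∧
        ∃ κ : ℂ, ∀ x : ℝ, x ^ 2 ≠ lam →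
          P.eval (x : ℂ) =
            κ * (((laguerreB (-1 / 2) (s + M + 1) * (laguerreAssoc (-1 / 2) s M).eval lam
                    * (hermiteON (2 * (s + M) + 2)).eval x
                  + laguerreB (-1 / 2) s
                    * (if 2 * s = 0 then 0 else (hermiteON (2 * s - 2)).eval x))
                / (x ^ 2 - lam) : ℝ) : ℂ)) ∧
      (∀ x : ℝ, x ^ 2 ≠ lam →
        ∑ i ∈ range (M + 1),
            (laguerreAssoc (-1 / 2) s i).eval lam * (hermiteON (2 * (s + i))).eval x =
          (laguerreB (-1 / 2) (s + M + 1) * (laguerreAssoc (-1 / 2) s M).eval lam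
              * (hermiteON (2 * (s + M) + 2)).eval x
            + laguerreB (-1 / 2) s
              * (if 2 * s = 0 then 0 else (hermiteON (2 * s - 2)).eval x))
            / (x ^ 2 - lam)) := by
  obtain ⟨y, hleast, hex, hiff⟩ := exists_isLeast_isOptimal s M
  simp only [eval_laguerreAssoc]
  refine ⟨y, hleast, hex, fun P => ?_, fun x hx => ?_⟩
  · rw [hiff]
    refine and_congr_right fun _ => exists_congr fun c => ?_
    rw [eq_C_mul_toComplex_iff P _ y]
    refine forall_congr' fun x => forall_congr' fun hx => ?_
    rw [eval_extremalPoly hleast.1 hx]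
    rfl
  · have h := eval_extremalPoly hleast.1 hx
    rw [extremalPoly, eval_finsetSum] at h
    simp only [eval_mul, eval_C] at h
    exact h

end OptHermite

/-! ### Both cases of the theorem, with `m = 2s` and `n = 2(s + M)`. -/

theorem corollary5p3 (n m : ℕ) (hn : Even n) (hm : Even m) (hmn : m ≤ n) :
    -- the optimal polynomials in the span of `h_0, …, h_n`
    (∃ lam : ℝ,
      IsLeast {x : ℝ | (OptHermite.laguerreON (-1 / 2) (n / 2 + 1)).eval x = 0} lam ∧
      (∃ P : Polynomial ℂ, OptHermite.IsOptimal (OptHermite.spaceN n) P) ∧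
      (∀ P : Polynomial ℂ, OptHermite.IsOptimal (OptHermite.spaceN n) P ↔
        P ∈ OptHermite.unitSphere (OptHermite.spaceN n) ∧
        ∃ κ : ℂ, ∀ x : ℝ, x ^ 2 ≠ lam →
          P.eval (x : ℂ) =
            κ * ((OptHermite.laguerreB (-1 / 2) (n / 2 + 1)
                * (OptHermite.laguerreON (-1 / 2) (n / 2)).eval lam
                * ((OptHermite.hermiteON (n + 2)).eval x / (x ^ 2 - lam)) : ℝ) : ℂ)) ∧
      -- the factor `κ` is the one in front of the expansion in Hermite polynomials
      (∀ x : ℝ, x ^ 2 ≠ lam →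
        ∑ l ∈ Finset.range (n / 2 + 1),
            (OptHermite.laguerreON (-1 / 2) l).eval lam * (OptHermite.hermiteON (2 * l)).eval x =
          OptHermite.laguerreB (-1 / 2) (n / 2 + 1)
            * (OptHermite.laguerreON (-1 / 2) (n / 2)).eval lam
            * ((OptHermite.hermiteON (n + 2)).eval x / (x ^ 2 - lam)))) ∧
    -- the optimal polynomials in the span of `h_m, …, h_n`; here `h_{-2} = 0`
    (∃ lam : ℝ,
      IsLeast {x : ℝ |
        (OptHermite.laguerreAssoc (-1 / 2) (m / 2) ((n - m) / 2 + 1)).eval x = 0} lam ∧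
      (∃ P : Polynomial ℂ, OptHermite.IsOptimal (OptHermite.spaceMN m n) P) ∧
      (∀ P : Polynomial ℂ, OptHermite.IsOptimal (OptHermite.spaceMN m n) P ↔
        P ∈ OptHermite.unitSphere (OptHermite.spaceMN m n) ∧
        ∃ κ : ℂ, ∀ x : ℝ, x ^ 2 ≠ lam →
          P.eval (x : ℂ) =
            κ * (((OptHermite.laguerreB (-1 / 2) (n / 2 + 1)
                    * (OptHermite.laguerreAssoc (-1 / 2) (m / 2) ((n - m) / 2)).eval lam
                    * (OptHermite.hermiteON (n + 2)).eval x
                  + OptHermite.laguerreB (-1 / 2) (m / 2)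
                    * (if m = 0 then 0 else (OptHermite.hermiteON (m - 2)).eval x))
                / (x ^ 2 - lam) : ℝ) : ℂ)) ∧
      (∀ x : ℝ, x ^ 2 ≠ lam →
        ∑ l ∈ Finset.Icc (m / 2) (n / 2),
            (OptHermite.laguerreAssoc (-1 / 2) (m / 2) (l - m / 2)).eval lam
              * (OptHermite.hermiteON (2 * l)).eval x =
          (OptHermite.laguerreB (-1 / 2) (n / 2 + 1)
              * (OptHermite.laguerreAssoc (-1 / 2) (m / 2) ((n - m) / 2)).eval lam
              * (OptHermite.hermiteON (n + 2)).eval x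
            + OptHermite.laguerreB (-1 / 2) (m / 2)
              * (if m = 0 then 0 else (OptHermite.hermiteON (m - 2)).eval x))
            / (x ^ 2 - lam))) := by
  obtain ⟨N, rfl⟩ := hn
  obtain ⟨s, rfl⟩ := hm
  obtain ⟨M, rfl⟩ : ∃ M, N = s + M := ⟨N - s, by omega⟩
  have e1 : (s + M + (s + M)) / 2 = s + M := by omega
  have e2 : (s + s) / 2 = s := by omega
  have e3 : (s + M + (s + M) - (s + s)) / 2 = M := by omega
  have e4 : s + M + (s + M) = 2 * (s + M) := by omega
  have e5 : s + s = 2 * s := by omega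
  rw [e1, e2, e3, e4, e5]
  refine ⟨?_, ?_⟩
  -- The full space is the block starting at index 0. Orthonormal and associated polynomials then
  -- differ by a nonzero constant `c`, which changes no zeros and is absorbed into `κ`.
  · obtain ⟨c, hc, hON⟩ := OptHermite.isRegularWeight_laguerreWeight.exists_orthonormalPoly_eq
    have hON' : ∀ l x, (OptHermite.laguerreON (-1 / 2) l).eval x =
        c * (OptHermite.laguerreAssoc (-1 / 2) 0 l).eval x := fun l x => by
      rw [OptHermite.laguerreON, hON, eval_mul, eval_C, OptHermite.laguerreAssoc]
    obtain ⟨y, h1, h2, h3, h4⟩ := OptHermite.exists_isLeast_isOptimal_iff_eval 0 (s + M)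
    simp only [mul_zero, zero_add, if_true, add_zero] at h1 h2 h3 h4
    refine ⟨y, ?_, h2, fun P => (h3 P).trans (and_congr_right fun _ => ?_), fun x hx => ?_⟩
    · simpa [hON', hc] using h1
    · have hcC : (c : ℂ) ≠ 0 := Complex.ofReal_ne_zero.2 hc
      constructor
      · rintro ⟨κ, hκ⟩
        refine ⟨κ / c, fun x hx => ?_⟩
        rw [hκ x hx, hON']
        push_cast
        field_simp
      · rintro ⟨κ, hκ⟩
        refine ⟨κ * c, fun x hx => ?_⟩
        rw [hκ x hx, hON']
        push_cast
        ring
    · have h := h4 x hx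
      simp only [hON', mul_assoc]
      rw [← Finset.mul_sum, h]
      ring
  · obtain ⟨y, h1, h2, h3, h4⟩ := OptHermite.exists_isLeast_isOptimal_iff_eval s M
    refine ⟨y, h1, h2, h3, fun x hx => ?_⟩
    rw [← h4 x hx, ← Finset.Ico_add_one_right_eq_Icc, Finset.sum_Ico_eq_sum_range,
      show s + M + 1 - s = M + 1 by omega]
    exact Finset.sum_congr rfl fun i _ => by rw [Nat.add_sub_cancel_left]
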